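/- \textbf{Theorem 3.} A disjunctive identity (d-identity) of a group $G$ is a formula $(f_1=1)\vee\dots\vee(f_n=1)$, where $f_1,\dots,f_n$ are elements of the free group on countably many variables, which is true for all values of the variables in $G$; an equation $f=h$ stands for $fh^{-1}=1$. A set of d-identities of a group $H$ is a basis of d-identities of $H$ if every group satisfying all of them satisfies every d-identity of $H$. Write $a^b=b^{-1}ab$ and $a^{3b}=(a^3)^b$, let $a\in\langle b\rangle$ denote the formula $(a=1)\vee(a=b)\vee(a=b^2)\vee(a=b^3)$, and let $\theta(x_1,x_2,x_3)$ be $$\Big[\bigvee_{i\ne j} x_i\in\langle x_j\rangle\Big]\vee\Big[\bigvee_{\sigma\in S_3}x_{\sigma(1)}\in\langle x_{\sigma(2)}x_{\sigma(3)}\rangle\Big]\vee\Big[\bigvee_{\sigma\in S_3}x_{\sigma(1)}x_{\sigma(2)}\in\langle x_{\sigma(2)}x_{\sigma(3)}\rangle\Big],$$ where $i,j$ run over $1,2,3$. Then the following seven formulas form a basis of d-identities of the alternating group $A_6$: (4.1) $\displaystyle\bigvee_{0\le i<j\le 360}(x_i=x_j)$; (4.2) $(x^3=1)\vee(x^4=1)\vee(x^5=1)$;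 (4.3) $\displaystyle\Big[\bigvee_{i}x_i^{20}=1\Big]\vee\Big[\bigvee_{i<j}x_i=x_j\Big]\vee\Big[\bigvee_{i<j}(x_ix_j)^{20}=1\Big]\vee\Big[\bigvee_{i<j}(x_ix_j^2)^{20}=1\Big]$, where $i,j$ run over $1,\dots,9$; (4.4) $(x_1^{30}=1)\vee(x_2^{30}=1)\vee((x_1x_2)^{15}=1)\vee((x_1x_2^2)^{15}=1)\vee((x_1x_2^3)^{15}=1)$; (4.5) $\displaystyle\theta(x_1,x_2,x_3)\vee\Big[\bigvee_i x_i^{15}=1\Big]\vee\Big[\bigvee_{i\ne j}(x_ix_j)^{15}=1\Big]\vee\Big[\bigvee_{i\ne j}(x_ix_j^2)^{15}=1\Big]\vee\Big[\bigvee_{i\ne j}(x_ix_j^3)^{15}=1\Big]$, where $i,j$ run over $1,2,3$; (4.6) $(x_1^{12}=1)\vee(x_2^{30}=1)\vee((x_1x_1^{x_2})^{12}=1)\vee((x_1x_1^{3x_2})^{12}=1)\vee((x_1^2x_1^{x_2})^{12}=1)$; (4.7) $(x_1^{12}=1)\vee(x_2^{12}=1)\vee((x_1x_2)^{12}=1)\vee((x_1x_2^2)^{12}=1)\vee((x_1x_2^3)^{12}=1)\vee((x_1x_2^4)^{12}=1)$.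 Concretely: all seven formulas hold in $A_6$; every group satisfying them satisfies all d-identities of $A_6$; and every group satisfying them is isomorphic to a section (a quotient of a subgroup) of $A_6$. -/

import Mathlib

universe u v

/-- A disjunctive formula `∀ x₀ x₁ …, (f₁ = 1) ∨ ⋯ ∨ (fₙ = 1)`: the finite set of the words
`f₁, …, fₙ` in the free group on countably many variables. -/
abbrev DFormula : Type := Finset (FreeGroup ℕ)

namespace DFormula

/-- `δ` is a disjunctive identity of `G`: for all values in `G` of the variables, at least one
of the equations `f = 1` of `δ` holds. -/
def HoldsIn (δ : DFormula) (G : Type v) [Group G] : Prop :=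
  ∀ g : ℕ → G, ∃ f ∈ δ, FreeGroup.lift g f = 1

/-- The one-equation formula `f = 1`. -/
def isOne (f : FreeGroup ℕ) : DFormula := {f}

/-- The one-equation formula `f = h`, written as `f h⁻¹ = 1`. -/
def eqn (f h : FreeGroup ℕ) : DFormula := {f * h⁻¹}

/-- Finite disjunction `⋁_{i ∈ s} δ i`. -/
def bigOr {ι : Type} (s : Finset ι) (δ : ι → DFormula) : DFormula := s.biUnion δ

/-- The variable `x_i`. -/
def x (i : ℕ) : FreeGroup ℕ := FreeGroup.of i

/-- The conjugate `a ^ b = b⁻¹ a b`. -/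
def conj (a b : FreeGroup ℕ) : FreeGroup ℕ := b⁻¹ * a * b

/-- The pairs `(i, j)` of elements of `s` with `i < j`. -/
def ltPairs (s : Finset ℕ) : Finset (ℕ × ℕ) := (s ×ˢ s).filter fun p => p.1 < p.2

/-- The formula `a ∈ ⟨b⟩`, that is, `(a = 1) ∨ (a = b) ∨ (a = b²) ∨ (a = b³)`. -/
def inCyc (a b : FreeGroup ℕ) : DFormula :=
  isOne a ∪ eqn a b ∪ eqn a (b ^ 2) ∪ eqn a (b ^ 3)

/-- The formula `θ(y 0, y 1, y 2)`. -/
def theta (y : Fin 3 → FreeGroup ℕ) : DFormula :=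
  bigOr (Finset.univ : Finset (Fin 3)).offDiag (fun p => inCyc (y p.1) (y p.2))
  ∪ bigOr (Finset.univ : Finset (Equiv.Perm (Fin 3)))
      (fun σ => inCyc (y (σ 0)) (y (σ 1) * y (σ 2)))
  ∪ bigOr (Finset.univ : Finset (Equiv.Perm (Fin 3)))
      (fun σ => inCyc (y (σ 0) * y (σ 1)) (y (σ 1) * y (σ 2)))

/-- `ω_n = ⋁_{0 ≤ i < j ≤ n} (x_i = x_j)`; it holds exactly in the groups of order at most `n`. -/
def omega (n : ℕ) : DFormula :=
  bigOr (ltPairs (Finset.Icc 0 n)) fun p => eqn (x p.1) (x p.2)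

/-- `(x³ = 1) ∨ (x⁴ = 1) ∨ (x⁵ = 1)`. -/
def delta2 : DFormula :=
  isOne (x 1 ^ 3) ∪ isOne (x 1 ^ 4) ∪ isOne (x 1 ^ 5)

/-- `[⋁ x_i²⁰ = 1] ∨ [⋁_{i<j} x_i = x_j] ∨ [⋁_{i<j} (x_i x_j)²⁰ = 1]
∨ [⋁_{i<j} (x_i x_j²)²⁰ = 1]`, with `i, j` in `{1, …, 9}`. -/
def delta3 : DFormula :=
  bigOr (Finset.Icc 1 9) (fun i => isOne (x i ^ 20))
  ∪ bigOr (ltPairs (Finset.Icc 1 9)) (fun p => eqn (x p.1) (x p.2))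
  ∪ bigOr (ltPairs (Finset.Icc 1 9)) (fun p => isOne ((x p.1 * x p.2) ^ 20))
  ∪ bigOr (ltPairs (Finset.Icc 1 9)) (fun p => isOne ((x p.1 * x p.2 ^ 2) ^ 20))

/-- `(x₁³⁰ = 1) ∨ (x₂³⁰ = 1) ∨ ((x₁x₂)¹⁵ = 1) ∨ ((x₁x₂²)¹⁵ = 1) ∨ ((x₁x₂³)¹⁵ = 1)`. -/
def delta4 : DFormula :=
  isOne (x 1 ^ 30) ∪ isOne (x 2 ^ 30) ∪ isOne ((x 1 * x 2) ^ 15)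
  ∪ isOne ((x 1 * x 2 ^ 2) ^ 15) ∪ isOne ((x 1 * x 2 ^ 3) ^ 15)

/-- `θ(x₁, x₂, x₃) ∨ [⋁_i x_i¹⁵ = 1] ∨ [⋁_{i≠j} (x_i x_j)¹⁵ = 1] ∨ [⋁_{i≠j} (x_i x_j²)¹⁵ = 1]
∨ [⋁_{i≠j} (x_i x_j³)¹⁵ = 1]`, with `i, j` in `{1, 2, 3}`. -/
def delta5 : DFormula :=
  theta ![x 1, x 2, x 3]
  ∪ bigOr (Finset.Icc 1 3) (fun i => isOne (x i ^ 15))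
  ∪ bigOr (Finset.Icc 1 3).offDiag (fun p => isOne ((x p.1 * x p.2) ^ 15))
  ∪ bigOr (Finset.Icc 1 3).offDiag (fun p => isOne ((x p.1 * x p.2 ^ 2) ^ 15))
  ∪ bigOr (Finset.Icc 1 3).offDiag (fun p => isOne ((x p.1 * x p.2 ^ 3) ^ 15))

/-- `(x₁¹² = 1) ∨ (x₂³⁰ = 1) ∨ ((x₁ x₁^{x₂})¹² = 1) ∨ ((x₁ (x₁³)^{x₂})¹² = 1)
∨ ((x₁² x₁^{x₂})¹² = 1)`. -/
def delta6 : DFormula :=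
  isOne (x 1 ^ 12) ∪ isOne (x 2 ^ 30) ∪ isOne ((x 1 * conj (x 1) (x 2)) ^ 12)
  ∪ isOne ((x 1 * conj (x 1 ^ 3) (x 2)) ^ 12) ∪ isOne ((x 1 ^ 2 * conj (x 1) (x 2)) ^ 12)

/-- `(x₁¹² = 1) ∨ (x₂¹² = 1) ∨ ((x₁x₂)¹² = 1) ∨ ((x₁x₂²)¹² = 1) ∨ ((x₁x₂³)¹² = 1)
∨ ((x₁x₂⁴)¹² = 1)`. -/
def delta7 : DFormula :=
  isOne (x 1 ^ 12) ∪ isOne (x 2 ^ 12) ∪ isOne ((x 1 * x 2) ^ 12)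
  ∪ isOne ((x 1 * x 2 ^ 2) ^ 12) ∪ isOne ((x 1 * x 2 ^ 3) ^ 12) ∪ isOne ((x 1 * x 2 ^ 4) ^ 12)

end DFormula

/-- `G` satisfies all formulas of `Γ`. -/
def Satisfies (G : Type v) [Group G] (Γ : Set DFormula) : Prop :=
  ∀ δ ∈ Γ, δ.HoldsIn G

/-- `G` belongs to the d-variety generated by `H`: every disjunctive identity of `H` is one
of `G`. -/
def InDVar (G : Type u) [Group G] (H : Type v) [Group H] : Prop :=
  ∀ δ : DFormula, δ.HoldsIn H → δ.HoldsIn G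

/-- `Γ` is a basis of disjunctive identities of `H`: its members are disjunctive identities of
`H`, and every group satisfying `Γ` belongs to the d-variety generated by `H`. -/
def IsDBasis (Γ : Set DFormula) (H : Type v) [Group H] : Prop :=
  Satisfies H Γ ∧ ∀ (G : Type u) [Group G], Satisfies G Γ → InDVar G H

/-- `G` is isomorphic to a section of `H`, that is, to a quotient of a subgroup of `H`. -/
def IsSection (G : Type u) [Group G] (H : Type v) [Group H] : Prop :=
  ∃ (K : Subgroup H) (N : Subgroup K) (_ : N.Normal), Nonempty (G ≃* K ⧸ N)

/-- The seven formulas. -/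
def sevenFormulas : Set DFormula :=
  {DFormula.omega 360, DFormula.delta2, DFormula.delta3, DFormula.delta4, DFormula.delta5,
    DFormula.delta6, DFormula.delta7}

open DFormula

section Formulas

variable {G : Type v} [Group G]

theorem holdsIn_of_injective {H : Type u} [Group H] (φ : H →* G) (hφ : Function.Injective φ)
    {δ : DFormula} (h : δ.HoldsIn G) : δ.HoldsIn H := by
  intro g
  obtain ⟨f, hf, h1⟩ := h (fun i => φ (g i))
  refine ⟨f, hf, hφ ?_⟩
  have : φ.comp (FreeGroup.lift g) = FreeGroup.lift (fun i => φ (g i)) := by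
    ext i; simp
  rw [← MonoidHom.comp_apply, this, h1, map_one]

theorem holdsIn_of_surjective {H : Type u} [Group H] (φ : G →* H) (hφ : Function.Surjective φ)
    {δ : DFormula} (h : δ.HoldsIn G) : δ.HoldsIn H := by
  intro g
  choose k hk using fun i => hφ (g i)
  obtain ⟨f, hf, h1⟩ := h k
  refine ⟨f, hf, ?_⟩
  have : φ.comp (FreeGroup.lift k) = FreeGroup.lift g := by
    ext i; simp [hk]
  rw [← this, MonoidHom.comp_apply, h1, map_one]

theorem Satisfies.of_injective {H : Type u} [Group H] {Γ : Set DFormula} (φ : H →* G)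
    (hφ : Function.Injective φ) (h : Satisfies G Γ) : Satisfies H Γ :=
  fun δ hδ => holdsIn_of_injective φ hφ (h δ hδ)

theorem Satisfies.subgroup {Γ : Set DFormula} (h : Satisfies G Γ) (K : Subgroup G) :
    Satisfies K Γ :=
  h.of_injective K.subtype K.subtype_injective

theorem IsSection.inDVar {H : Type u} [Group H] (h : IsSection H G) : InDVar H G := by
  obtain ⟨K, N, _, ⟨e⟩⟩ := h
  intro δ hδ
  have h1 : δ.HoldsIn K := holdsIn_of_injective K.subtype K.subtype_injective hδ
  have h2 : δ.HoldsIn (K ⧸ N) :=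
    holdsIn_of_surjective (QuotientGroup.mk' N) (QuotientGroup.mk'_surjective N) h1
  exact holdsIn_of_injective e.toMonoidHom e.injective h2

theorem isSection_of_injective {H : Type u} [Group H] (φ : H →* G)
    (hφ : Function.Injective φ) : IsSection H G := by
  refine ⟨φ.range, ⊥, inferInstance, ⟨?_⟩⟩
  exact (MonoidHom.ofInjective hφ).trans QuotientGroup.quotientBot.symm

theorem omega_holdsIn_iff (n : ℕ) :
    (omega n).HoldsIn G ↔ ∀ g : ℕ → G, ∃ i j, i < j ∧ j ≤ n ∧ g i = g j := by
  refine forall_congr' fun g => ?_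
  simp only [omega, bigOr, eqn, x, ltPairs, Finset.mem_biUnion, Finset.mem_filter,
    Finset.mem_product, Finset.mem_Icc, Finset.mem_singleton, Prod.exists]
  constructor
  · rintro ⟨f, ⟨i, j, ⟨⟨⟨_, _⟩, _, hj⟩, hij⟩, rfl⟩, h⟩
    exact ⟨i, j, hij, hj, by simpa [mul_inv_eq_one] using h⟩
  · rintro ⟨i, j, hij, hj, h⟩
    exact ⟨_, ⟨i, j, ⟨⟨⟨by omega, by omega⟩, by omega, hj⟩, hij⟩, rfl⟩, by simp [h]⟩

theorem delta2_holdsIn_iff :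
    delta2.HoldsIn G ↔ ∀ a : G, a ^ 3 = 1 ∨ a ^ 4 = 1 ∨ a ^ 5 = 1 := by
  have : delta2.HoldsIn G ↔ ∀ g : ℕ → G, g 1 ^ 3 = 1 ∨ g 1 ^ 4 = 1 ∨ g 1 ^ 5 = 1 := by
    simp [HoldsIn, delta2, isOne, x]
  rw [this]
  exact ⟨fun h a => h fun _ => a, fun h g => h _⟩

theorem delta4_holdsIn_iff :
    delta4.HoldsIn G ↔ ∀ a b : G, a ^ 30 = 1 ∨ b ^ 30 = 1 ∨ (a * b) ^ 15 = 1 ∨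
      (a * b ^ 2) ^ 15 = 1 ∨ (a * b ^ 3) ^ 15 = 1 := by
  have : delta4.HoldsIn G ↔ ∀ g : ℕ → G, g 1 ^ 30 = 1 ∨ g 2 ^ 30 = 1 ∨
      (g 1 * g 2) ^ 15 = 1 ∨ (g 1 * g 2 ^ 2) ^ 15 = 1 ∨ (g 1 * g 2 ^ 3) ^ 15 = 1 := by
    simp [HoldsIn, delta4, isOne, x]
  rw [this]
  exact ⟨fun h a b => h fun i => if i = 1 then a else b, fun h g => h _ _⟩

theorem delta6_holdsIn_iff :
    delta6.HoldsIn G ↔ ∀ a b : G, a ^ 12 = 1 ∨ b ^ 30 = 1 ∨ (a * (b⁻¹ * a * b)) ^ 12 = 1 ∨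
      (a * (b⁻¹ * a ^ 3 * b)) ^ 12 = 1 ∨ (a ^ 2 * (b⁻¹ * a * b)) ^ 12 = 1 := by
  have : delta6.HoldsIn G ↔ ∀ g : ℕ → G, g 1 ^ 12 = 1 ∨ g 2 ^ 30 = 1 ∨
      (g 1 * ((g 2)⁻¹ * g 1 * g 2)) ^ 12 = 1 ∨ (g 1 * ((g 2)⁻¹ * g 1 ^ 3 * g 2)) ^ 12 = 1 ∨
      (g 1 ^ 2 * ((g 2)⁻¹ * g 1 * g 2)) ^ 12 = 1 := by
    simp [HoldsIn, delta6, isOne, x, conj]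
  rw [this]
  exact ⟨fun h a b => h fun i => if i = 1 then a else b, fun h g => h _ _⟩

theorem delta7_holdsIn_iff :
    delta7.HoldsIn G ↔ ∀ a b : G, a ^ 12 = 1 ∨ b ^ 12 = 1 ∨ (a * b) ^ 12 = 1 ∨
      (a * b ^ 2) ^ 12 = 1 ∨ (a * b ^ 3) ^ 12 = 1 ∨ (a * b ^ 4) ^ 12 = 1 := by
  have : delta7.HoldsIn G ↔ ∀ g : ℕ → G, g 1 ^ 12 = 1 ∨ g 2 ^ 12 = 1 ∨
      (g 1 * g 2) ^ 12 = 1 ∨ (g 1 * g 2 ^ 2) ^ 12 = 1 ∨ (g 1 * g 2 ^ 3) ^ 12 = 1 ∨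
      (g 1 * g 2 ^ 4) ^ 12 = 1 := by
    simp [HoldsIn, delta7, isOne, x]
  rw [this]
  exact ⟨fun h a b => h fun i => if i = 1 then a else b, fun h g => h _ _⟩

theorem delta3_holdsIn_iff :
    delta3.HoldsIn G ↔ ∀ g : ℕ → G, (∃ i, 1 ≤ i ∧ i ≤ 9 ∧ g i ^ 20 = 1) ∨
      ∃ i j, 1 ≤ i ∧ i < j ∧ j ≤ 9 ∧
        (g i = g j ∨ (g i * g j) ^ 20 = 1 ∨ (g i * g j ^ 2) ^ 20 = 1) := by
  refine forall_congr' fun g => ?_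
  simp only [delta3, bigOr, eqn, isOne, x, ltPairs, Finset.mem_union, Finset.mem_biUnion,
    Finset.mem_filter, Finset.mem_product, Finset.mem_Icc, Finset.mem_singleton, Prod.exists]
  constructor
  · rintro ⟨f, ((⟨i, ⟨h1, h2⟩, rfl⟩ | ⟨i, j, ⟨⟨⟨h1, h2⟩, h3, h4⟩, h5⟩, rfl⟩) |
      ⟨i, j, ⟨⟨⟨h1, h2⟩, h3, h4⟩, h5⟩, rfl⟩) | ⟨i, j, ⟨⟨⟨h1, h2⟩, h3, h4⟩, h5⟩, rfl⟩, h⟩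
    · exact Or.inl ⟨i, h1, h2, by simpa using h⟩
    · exact Or.inr ⟨i, j, h1, h5, h4, Or.inl (by simpa [mul_inv_eq_one] using h)⟩
    · exact Or.inr ⟨i, j, h1, h5, h4, Or.inr (Or.inl (by simpa using h))⟩
    · exact Or.inr ⟨i, j, h1, h5, h4, Or.inr (Or.inr (by simpa using h))⟩
  · rintro (⟨i, h1, h2, h⟩ | ⟨i, j, h1, h5, h4, h | h | h⟩)
    · exact ⟨_, Or.inl (Or.inl (Or.inl ⟨i, ⟨h1, h2⟩, rfl⟩)), by simpa using h⟩
    · exact ⟨_, Or.inl (Or.inl (Or.inr ⟨i, j, ⟨⟨⟨h1, by omega⟩, by omega, h4⟩, h5⟩, rfl⟩)),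
        by simp [h]⟩
    · exact ⟨_, Or.inl (Or.inr ⟨i, j, ⟨⟨⟨h1, by omega⟩, by omega, h4⟩, h5⟩, rfl⟩),
        by simpa using h⟩
    · exact ⟨_, Or.inr ⟨i, j, ⟨⟨⟨h1, by omega⟩, by omega, h4⟩, h5⟩, rfl⟩, by simpa using h⟩

/-- The values `1, b, b², b³` of `a` in the formula `a ∈ ⟨b⟩`. -/
def InCycVal (a b : G) : Prop := a = 1 ∨ a = b ∨ a = b ^ 2 ∨ a = b ^ 3

theorem exists_inCyc_iff (g : ℕ → G) (a b : FreeGroup ℕ) :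
    (∃ f ∈ inCyc a b, FreeGroup.lift g f = 1) ↔
      InCycVal (FreeGroup.lift g a) (FreeGroup.lift g b) := by
  simp [inCyc, isOne, eqn, InCycVal, mul_inv_eq_one]

theorem exists_bigOr_iff {ι : Type} (s : Finset ι) (δ : ι → DFormula) (g : ℕ → G) :
    (∃ f ∈ bigOr s δ, FreeGroup.lift g f = 1) ↔
      ∃ i ∈ s, ∃ f ∈ δ i, FreeGroup.lift g f = 1 := by
  simp only [bigOr, Finset.mem_biUnion]
  constructor
  · rintro ⟨f, ⟨i, hi, hf⟩, h⟩; exact ⟨i, hi, f, hf, h⟩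
  · rintro ⟨i, hi, f, hf, h⟩; exact ⟨f, ⟨i, hi, hf⟩, h⟩

theorem exists_union_iff (δ ε : DFormula) (g : ℕ → G) :
    (∃ f ∈ δ ∪ ε, FreeGroup.lift g f = 1) ↔
      (∃ f ∈ δ, FreeGroup.lift g f = 1) ∨ ∃ f ∈ ε, FreeGroup.lift g f = 1 := by
  simp [or_and_right, exists_or]

/-- The value of `θ` at `y 0, y 1, y 2`. -/
def ThetaVal (y : Fin 3 → G) : Prop :=
  (∃ i j, i ≠ j ∧ InCycVal (y i) (y j)) ∨
  (∃ σ : Equiv.Perm (Fin 3), InCycVal (y (σ 0)) (y (σ 1) * y (σ 2))) ∨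
  ∃ σ : Equiv.Perm (Fin 3), InCycVal (y (σ 0) * y (σ 1)) (y (σ 1) * y (σ 2))

theorem exists_theta_iff (g : ℕ → G) (y : Fin 3 → FreeGroup ℕ) :
    (∃ f ∈ theta y, FreeGroup.lift g f = 1) ↔ ThetaVal fun i => FreeGroup.lift g (y i) := by
  simp only [theta, exists_union_iff, exists_bigOr_iff, exists_inCyc_iff, ThetaVal, map_mul,
    Finset.mem_offDiag, Finset.mem_univ, true_and, Prod.exists, or_assoc]

theorem delta5_holdsIn_iff :
    delta5.HoldsIn G ↔ ∀ y : Fin 3 → G, ThetaVal y ∨ (∃ i, y i ^ 15 = 1) ∨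
      ∃ i j, i ≠ j ∧ ((y i * y j) ^ 15 = 1 ∨ (y i * y j ^ 2) ^ 15 = 1 ∨
        (y i * y j ^ 3) ^ 15 = 1) := by
  have key : ∀ g : ℕ → G, (∃ f ∈ delta5, FreeGroup.lift g f = 1) ↔
      (ThetaVal (fun i : Fin 3 => g (i + 1)) ∨ (∃ i : Fin 3, g (i + 1) ^ 15 = 1) ∨
      ∃ i j : Fin 3, i ≠ j ∧ ((g (i + 1) * g (j + 1)) ^ 15 = 1 ∨
        (g (i + 1) * g (j + 1) ^ 2) ^ 15 = 1 ∨ (g (i + 1) * g (j + 1) ^ 3) ^ 15 = 1)) := by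
    intro g
    have h0 : (fun i : Fin 3 => FreeGroup.lift g ((![x 1, x 2, x 3] : Fin 3 → FreeGroup ℕ) i)) =
        fun i : Fin 3 => g (i + 1) := by
      funext i; fin_cases i <;> simp [x]
    simp only [delta5, exists_union_iff, exists_bigOr_iff, exists_theta_iff, h0]
    simp only [isOne, x, Finset.mem_singleton, exists_eq_left, map_mul, map_pow,
      FreeGroup.lift_apply_of, Finset.mem_offDiag, Finset.mem_Icc, Prod.exists, or_assoc]
    have hof : ∀ p : ℕ → ℕ → Prop,
        (∃ i j, ((1 ≤ i ∧ i ≤ 3) ∧ (1 ≤ j ∧ j ≤ 3) ∧ i ≠ j) ∧ p i j) ↔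
          ∃ i j : Fin 3, i ≠ j ∧ p (i + 1) (j + 1) := by
      intro p
      constructor
      · rintro ⟨i, j, ⟨⟨h1, h2⟩, ⟨h3, h4⟩, h5⟩, h⟩
        refine ⟨⟨i - 1, by omega⟩, ⟨j - 1, by omega⟩, ?_, ?_⟩
        · simp only [ne_eq, Fin.mk.injEq]; omega
        · simpa [Nat.sub_add_cancel h1, Nat.sub_add_cancel h3] using h
      · rintro ⟨i, j, hij, h⟩
        exact ⟨i + 1, j + 1, ⟨⟨by omega, by omega⟩, ⟨by omega, by omega⟩,
          by simpa [Fin.ext_iff] using hij⟩, h⟩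
    have hof1 : ∀ p : ℕ → Prop, (∃ i, (1 ≤ i ∧ i ≤ 3) ∧ p i) ↔ ∃ i : Fin 3, p (i + 1) := by
      intro p
      constructor
      · rintro ⟨i, ⟨h1, h2⟩, h⟩
        exact ⟨⟨i - 1, by omega⟩, by simpa [Nat.sub_add_cancel h1] using h⟩
      · rintro ⟨i, h⟩
        exact ⟨i + 1, ⟨by omega, by omega⟩, h⟩
    simp only [hof1 fun i => g i ^ 15 = 1, hof fun i j => (g i * g j) ^ 15 = 1,
      hof fun i j => (g i * g j ^ 2) ^ 15 = 1, hof fun i j => (g i * g j ^ 3) ^ 15 = 1,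
      ← exists_or, ← and_or_left]
  constructor
  · intro h y
    have := (key fun n => if h : n - 1 < 3 then y ⟨n - 1, h⟩ else 1).1 (h _)
    simpa using this
  · intro h g
    exact (key g).2 (h fun i => g (i + 1))

theorem satisfies_sevenFormulas_iff :
    Satisfies G sevenFormulas ↔ (omega 360).HoldsIn G ∧ delta2.HoldsIn G ∧ delta3.HoldsIn G ∧
      delta4.HoldsIn G ∧ delta5.HoldsIn G ∧ delta6.HoldsIn G ∧ delta7.HoldsIn G := by
  simp [Satisfies, sevenFormulas]

end Formulas

namespace Satisfies

variable {G : Type v} [Group G] (hG : Satisfies G sevenFormulas)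
include hG

theorem finite : Finite G := by
  have h := (omega_holdsIn_iff 360).1 (satisfies_sevenFormulas_iff.1 hG).1
  by_contra hf
  rw [not_finite_iff_infinite] at hf
  obtain ⟨i, j, hij, _, h1⟩ := h (Infinite.natEmbedding G)
  exact hij.ne ((Infinite.natEmbedding G).injective h1)

theorem orderOf_cases (a : G) :
    orderOf a = 1 ∨ orderOf a = 2 ∨ orderOf a = 3 ∨ orderOf a = 4 ∨ orderOf a = 5 := by
  have h := delta2_holdsIn_iff.1 (satisfies_sevenFormulas_iff.1 hG).2.1 a
  simp only [← orderOf_dvd_iff_pow_eq_one] at h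
  rcases h with h | h | h <;>
  · have := Nat.le_of_dvd (by norm_num) h
    interval_cases orderOf a <;> omega

omit hG in
theorem _root_.eq_one_of_pow_eq_one_of_coprime {a : G} {m n : ℕ} (hm : a ^ m = 1)
    (hn : a ^ n = 1) (h : Nat.Coprime m n) : a = 1 := by
  rw [← orderOf_dvd_iff_pow_eq_one] at hm hn
  exact orderOf_eq_one_iff.1 (Nat.dvd_one.1 (h ▸ Nat.dvd_gcd hm hn))

theorem pow_five_eq_one_of_card_eq {k : ℕ} (hc : Nat.card G = 5 ^ k) (a : G) : a ^ 5 = 1 := by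
  have := hG.finite
  obtain ⟨j, -, hj⟩ := (Nat.dvd_prime_pow (by norm_num)).1 (hc ▸ orderOf_dvd_natCard a)
  rw [← orderOf_dvd_iff_pow_eq_one]
  rcases j with _ | _ | j
  · simp [hj]
  · simp [hj]
  · have h1 : 1 ≤ 5 ^ j := Nat.one_le_pow _ _ (by norm_num)
    have := hG.orderOf_cases a
    rw [hj, pow_succ, pow_succ] at this
    omega

theorem pow_three_eq_one_of_card_eq {k : ℕ} (hc : Nat.card G = 3 ^ k) (a : G) : a ^ 3 = 1 := by
  have := hG.finite
  obtain ⟨j, -, hj⟩ := (Nat.dvd_prime_pow (by norm_num)).1 (hc ▸ orderOf_dvd_natCard a)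
  rw [← orderOf_dvd_iff_pow_eq_one]
  rcases j with _ | _ | j
  · simp [hj]
  · simp [hj]
  · have h1 : 1 ≤ 3 ^ j := Nat.one_le_pow _ _ (by norm_num)
    have := hG.orderOf_cases a
    rw [hj, pow_succ, pow_succ] at this
    omega

theorem card_ne_twentyFive : Nat.card G ≠ 25 := by
  intro hc
  have := hG.finite
  have h5 : ∀ a : G, a ^ 5 = 1 := hG.pow_five_eq_one_of_card_eq (k := 2) hc
  have h12 : ∀ a : G, a ^ 12 = 1 → a = 1 := fun a h =>
    eq_one_of_pow_eq_one_of_coprime (h5 a) h (by norm_num)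
  obtain ⟨b, hb⟩ : ∃ b : G, b ≠ 1 := by
    have : Nontrivial G := Finite.one_lt_card_iff_nontrivial.1 (by omega)
    exact exists_ne 1
  obtain ⟨a, ha⟩ : ∃ a : G, a ∉ Subgroup.zpowers b := by
    by_contra! h
    have h1 : Subgroup.zpowers b = ⊤ := (Subgroup.eq_top_iff' _).2 h
    have h2 : Nat.card (Subgroup.zpowers b) = 25 := by rw [h1, Subgroup.card_top, hc]
    rw [Nat.card_zpowers] at h2
    have := hG.orderOf_cases b
    omega
  have hab : ∀ k : ℕ, a * b ^ k ≠ 1 := fun k h => ha <| by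
    rw [mul_eq_one_iff_eq_inv.1 h]
    exact inv_mem (pow_mem (Subgroup.mem_zpowers b) k)
  rcases delta7_holdsIn_iff.1 (satisfies_sevenFormulas_iff.1 hG).2.2.2.2.2.2 a b with
    h | h | h | h | h | h
  · exact hab 0 (by simpa using h12 _ h)
  · exact hb (h12 _ h)
  · exact hab 1 (by simpa using h12 _ h)
  · exact hab 2 (h12 _ h)
  · exact hab 3 (h12 _ h)
  · exact hab 4 (h12 _ h)

theorem card_ne_twentySeven : Nat.card G ≠ 27 := by
  intro hc
  have := hG.finite
  have h3 : ∀ a : G, a ^ 3 = 1 := hG.pow_three_eq_one_of_card_eq (k := 3) hc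
  have h20 : ∀ a : G, a ^ 20 = 1 → a = 1 := fun a h =>
    eq_one_of_pow_eq_one_of_coprime (h3 a) h (by norm_num)
  have : Fact (Nat.Prime 3) := ⟨by norm_num⟩
  obtain ⟨M, hM⟩ := Sylow.exists_subgroup_card_pow_prime (G := G) 3 (n := 2) (by rw [hc]; norm_num)
  have hidx : M.index = 3 := by
    have := M.card_mul_index
    rw [hM, hc] at this
    omega
  have hn : M.Normal := Subgroup.normal_of_index_eq_minFac_card (by
    rw [hidx, hc]; norm_num)
  obtain ⟨a, ha⟩ : ∃ a : G, a ∉ M := by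
    by_contra! h
    rw [(Subgroup.eq_top_iff' _).2 h, Subgroup.index_top] at hidx
    omega
  let ε : Fin 9 ≃ M := (Finite.equivFinOfCardEq (by rw [hM]; norm_num)).symm
  let g : ℕ → G := fun i => if h : i - 1 < 9 then a * ε ⟨i - 1, h⟩ else 1
  have hg : ∀ i (h1 : 1 ≤ i) (h2 : i ≤ 9), g i = a * ε ⟨i - 1, by omega⟩ := fun i h1 h2 =>
    dif_pos (by omega)
  have hinj : ∀ i j, 1 ≤ i → i < j → j ≤ 9 → g i ≠ g j := by
    intro i j h1 hij h2 h
    rw [hg i h1 (by omega), hg j (by omega) h2, mul_right_inj, SetLike.coe_eq_coe,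
      ε.apply_eq_iff_eq, Fin.mk.injEq] at h
    omega
  rcases delta3_holdsIn_iff.1 (satisfies_sevenFormulas_iff.1 hG).2.2.1 g with
    ⟨i, h1, h2, h⟩ | ⟨i, j, h1, hij, h2, h | h | h⟩
  · have h := h20 _ h
    rw [hg i h1 h2, mul_eq_one_iff_eq_inv] at h
    exact ha (h ▸ inv_mem (ε _).2)
  · exact hinj i j h1 hij h2 h
  · have h := h20 _ h
    rw [hg i h1 (by omega), hg j (by omega) h2] at h
    have hq := congrArg (QuotientGroup.mk' M) h
    have hm : ∀ m : M, QuotientGroup.mk' M (m : G) = 1 := fun m =>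
      (QuotientGroup.eq_one_iff _).2 m.2
    simp only [map_mul, hm, mul_one, map_one] at hq
    have h1 : QuotientGroup.mk' M a = 1 :=
      eq_one_of_pow_eq_one_of_coprime (m := 2) (n := 3) (by rw [pow_two, hq])
        (by rw [← map_pow, h3, map_one]) (by norm_num)
    exact ha ((QuotientGroup.eq_one_iff a).1 h1)
  · have h := h20 _ h
    rw [mul_eq_one_iff_eq_inv] at h
    refine hinj i j h1 hij h2 (h.trans ?_)
    rw [inv_eq_iff_mul_eq_one, ← pow_succ, h3]

theorem eq_or_of_commuting_involutions {x y z : G} (hx : orderOf x = 2) (hy : orderOf y = 2)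
    (hz : orderOf z = 2) (hxy : Commute x y) (hxz : Commute x z) (hyz : Commute y z) :
    x = y ∨ x = z ∨ y = z ∨ z = x * y := by
  by_contra! hne
  obtain ⟨n1, n2, n3, n4⟩ := hne
  have x2 : x ^ 2 = 1 := hx ▸ pow_orderOf_eq_one x
  have y2 : y ^ 2 = 1 := hy ▸ pow_orderOf_eq_one y
  have z2 : z ^ 2 = 1 := hz ▸ pow_orderOf_eq_one z
  have x1 : x ≠ 1 := fun h => by simp [h] at hx
  have y1 : y ≠ 1 := fun h => by simp [h] at hy
  have z1 : z ≠ 1 := fun h => by simp [h] at hz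
  have v2 : ∀ i, ![x, y, z] i ^ 2 = 1 := by
    intro i; fin_cases i <;> simp [x2, y2, z2]
  have v1 : ∀ i, ![x, y, z] i ≠ 1 := by
    intro i; fin_cases i <;> simp [x1, y1, z1]
  have vinj : ∀ i j, i ≠ j → ![x, y, z] i ≠ ![x, y, z] j := by
    intro i j; fin_cases i <;> fin_cases j <;> simp [n1, n2, n3, n1.symm, n2.symm, n3.symm]
  have vc : ∀ i j, Commute (![x, y, z] i) (![x, y, z] j) := by
    intro i j
    fin_cases i <;> fin_cases j <;> simp [hxy, hxz, hyz, hxy.symm, hxz.symm, hyz.symm]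
  have xyz : x * y * z ≠ 1 := fun h => n4 (by
    rw [← inv_eq_iff_mul_eq_one.2 h, inv_eq_iff_mul_eq_one.2 ]
    rw [← pow_two, hxy.mul_pow, x2, y2, one_mul])
  have v3 : ∀ σ : Equiv.Perm (Fin 3),
      ![x, y, z] (σ 0) * (![x, y, z] (σ 1) * ![x, y, z] (σ 2)) ≠ 1 := by
    have hyx : y * x = x * y := hxy.eq.symm
    have hzx : z * x = x * z := hxz.eq.symm
    have hzy : z * y = y * z := hyz.eq.symm
    have hyx' : ∀ u, y * (x * u) = x * (y * u) := fun u => by rw [← mul_assoc, hyx, mul_assoc]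
    have hzx' : ∀ u, z * (x * u) = x * (z * u) := fun u => by rw [← mul_assoc, hzx, mul_assoc]
    rw [mul_assoc] at xyz
    have : ∀ a b c : Fin 3, a ≠ b → a ≠ c → b ≠ c →
        ![x, y, z] a * (![x, y, z] b * ![x, y, z] c) ≠ 1 := by
      intro a b c
      fin_cases a <;> fin_cases b <;> fin_cases c <;>
        simp [hyx, hzx, hzy, hyx', hzx', xyz]
    intro σ
    exact this _ _ _ (by simp) (by simp) (by simp)
  have odd : ∀ a : G, a ^ 2 = 1 → a ^ 15 = 1 → a = 1 := fun a h h' =>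
    eq_one_of_pow_eq_one_of_coprime h h' (by norm_num)
  have inv_eq : ∀ a : G, a ^ 2 = 1 → a⁻¹ = a := fun a h => by
    rw [inv_eq_iff_mul_eq_one, ← pow_two, h]
  have cyc : ∀ a b : G, a ≠ 1 → b ^ 2 = 1 → InCycVal a b → a = b := by
    rintro a b ha hb (h | h | h | h)
    · exact absurd h ha
    · exact h
    · exact absurd (h.trans hb) ha
    · rw [h, pow_succ, hb, one_mul]
  have vm2 : ∀ i j, (![x, y, z] i * ![x, y, z] j) ^ 2 = 1 := fun i j => by
    rw [(vc i j).mul_pow, v2, v2, one_mul]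
  have vm1 : ∀ i j, i ≠ j → ![x, y, z] i * ![x, y, z] j ≠ 1 := fun i j hij h =>
    vinj i j hij (by rw [mul_eq_one_iff_eq_inv.1 h, inv_eq _ (v2 j)])
  rcases delta5_holdsIn_iff.1 (satisfies_sevenFormulas_iff.1 hG).2.2.2.2.1 ![x, y, z] with
    (⟨i, j, hij, h⟩ | ⟨σ, h⟩ | ⟨σ, h⟩) | ⟨i, h⟩ | ⟨i, j, hij, h | h | h⟩
  · exact vinj i j hij (cyc _ _ (v1 i) (v2 j) h)
  · have h := cyc _ _ (v1 _) (vm2 _ _) h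
    refine v3 σ ?_
    rw [← h, ← pow_two, v2]
  · have h := cyc _ _ (vm1 _ _ (by simp)) (vm2 _ _) h
    rw [(vc (σ 0) (σ 1)).eq, mul_right_inj] at h
    exact vinj _ _ (by simp) h
  · exact v1 i (odd _ (v2 i) h)
  · exact vm1 i j hij (odd _ (vm2 i j) h)
  · rw [v2, mul_one] at h
    exact v1 i (odd _ (v2 i) h)
  · rw [pow_succ (![x, y, z] j) 2, v2, one_mul] at h
    exact vm1 i j hij (odd _ (vm2 i j) h)

theorem orderOf_of_card_eq_two_pow {k : ℕ} (hc : Nat.card G = 2 ^ k) (a : G) :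
    orderOf a = 1 ∨ orderOf a = 2 ∨ orderOf a = 4 := by
  have := hG.finite
  have h1 : ∀ p, p.Prime → p ∣ orderOf a → p = 2 := fun p hp h =>
    (Nat.prime_dvd_prime_iff_eq hp Nat.prime_two).1
      (hp.dvd_of_dvd_pow ((h.trans (orderOf_dvd_natCard a)).trans (dvd_of_eq hc)))
  rcases hG.orderOf_cases a with h | h | h | h | h
  · exact Or.inl h
  · exact Or.inr (Or.inl h)
  · exact absurd (h1 3 (by norm_num) (by rw [h])) (by norm_num)
  · exact Or.inr (Or.inr h)
  · exact absurd (h1 5 (by norm_num) (by rw [h])) (by norm_num)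

theorem exists_even_of_orderOf_eq_four {x y : G} (hx : orderOf x = 4) (hy : orderOf y = 4) :
    (x * y) ^ 15 = 1 ∨ (x * y ^ 2) ^ 15 = 1 ∨ (x * y ^ 3) ^ 15 = 1 := by
  have h30 : ∀ z : G, orderOf z = 4 → z ^ 30 ≠ 1 := fun z hz h => by
    rw [← orderOf_dvd_iff_pow_eq_one, hz] at h
    omega
  rcases delta4_holdsIn_iff.1 (satisfies_sevenFormulas_iff.1 hG).2.2.2.1 x y with h | h | h
  · exact absurd h (h30 x hx)
  · exact absurd h (h30 y hy)
  · exact h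

theorem mem_zpowers_of_orderOf_eq_four {k : ℕ} (hc : Nat.card G = 2 ^ k) {x y : G}
    (hx : orderOf x = 4) (hy : orderOf y = 4) : y ∈ Subgroup.zpowers x := by
  have odd : ∀ a : G, a ^ 15 = 1 → a = 1 := fun a h => by
    rw [← orderOf_dvd_iff_pow_eq_one] at h
    rcases hG.orderOf_of_card_eq_two_pow hc a with h1 | h1 | h1
    · exact orderOf_eq_one_iff.1 h1
    all_goals rw [h1] at h; omega
  have y4 : y ^ 4 = 1 := hy ▸ pow_orderOf_eq_one y
  rcases hG.exists_even_of_orderOf_eq_four hx hy with h | h | h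
  · rw [← inv_eq_of_mul_eq_one_right (odd _ h)]
    exact inv_mem (Subgroup.mem_zpowers x)
  · exfalso
    have h1 : x = (y ^ 2)⁻¹ := mul_eq_one_iff_eq_inv.1 (odd _ h)
    have h2 : x ^ 2 = 1 := by rw [h1, inv_pow, ← pow_mul, y4, inv_one]
    have := Nat.le_of_dvd (by norm_num) (orderOf_dvd_of_pow_eq_one h2)
    omega
  · have h1 : x = (y ^ 3)⁻¹ := mul_eq_one_iff_eq_inv.1 (odd _ h)
    have h2 : x = y := by rw [h1, inv_eq_iff_mul_eq_one, ← pow_succ, y4]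
    rw [h2]
    exact Subgroup.mem_zpowers y

theorem inverts_of_notMem_zpowers {k : ℕ} (hc : Nat.card G = 2 ^ k) {x y : G}
    (hx : orderOf x = 4) (hy : y ∉ Subgroup.zpowers x) : orderOf y = 2 ∧ y * x = x⁻¹ * y := by
  have key : ∀ z, z ∉ Subgroup.zpowers x → orderOf z = 2 := fun z hz => by
    rcases hG.orderOf_of_card_eq_two_pow hc z with h | h | h
    · exact absurd (orderOf_eq_one_iff.1 h ▸ one_mem _) hz
    · exact h
    · exact absurd (hG.mem_zpowers_of_orderOf_eq_four hc hx h) hz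
  have h1 := key y hy
  have h2 : orderOf (y * x) = 2 := key _ fun h => hy
    ((Subgroup.mul_mem_cancel_right _ (Subgroup.mem_zpowers x)).1 h)
  refine ⟨h1, ?_⟩
  have h3 : y * y = 1 := by rw [← pow_two, ← h1, pow_orderOf_eq_one]
  have h4 : y * x * (y * x) = 1 := by rw [← pow_two, ← h2, pow_orderOf_eq_one]
  have h5 : (y * x)⁻¹ = y * x := inv_eq_of_mul_eq_one_right h4
  rw [← h5, mul_inv_rev, inv_eq_of_mul_eq_one_right h3]

theorem exists_orderOf_eq_four {k : ℕ} (hc : Nat.card G = 2 ^ k) (hk : 3 ≤ k) :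
    ∃ x : G, orderOf x = 4 := by
  have := hG.finite
  by_contra! h
  have h2 : ∀ a : G, a ≠ 1 → orderOf a = 2 := fun a ha => by
    rcases hG.orderOf_of_card_eq_two_pow hc a with h1 | h1 | h1
    · exact absurd (orderOf_eq_one_iff.1 h1) ha
    · exact h1
    · exact absurd h1 (h a)
  have hsq : ∀ a : G, a * a = 1 := fun a => by
    by_cases ha : a = 1
    · simp [ha]
    · rw [← pow_two, ← h2 a ha, pow_orderOf_eq_one]
  have hcomm : ∀ a b : G, Commute a b := fun a b => by
    have h1 : ∀ a : G, a⁻¹ = a := fun a => inv_eq_of_mul_eq_one_right (hsq a)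
    have := h1 (a * b)
    rw [mul_inv_rev, h1, h1] at this
    exact this.symm
  have hcard : 8 ≤ Nat.card G := by
    rw [hc]; exact Nat.pow_le_pow_right (n := 2) (by norm_num) hk
  classical
  have hnot : ∀ s : Finset G, s.card ≤ 4 → ∃ a, a ∉ s := fun s hs => by
    by_contra! h1
    have : Fintype G := Fintype.ofFinite G
    have h3 : s = Finset.univ := Finset.eq_univ_iff_forall.2 h1
    rw [h3, Finset.card_univ, ← Nat.card_eq_fintype_card] at hs
    omega
  obtain ⟨a, ha⟩ := hnot {1} (by simp)
  obtain ⟨b, hb⟩ := hnot {1, a} ((Finset.card_le_two (a := (1 : G)) (b := a)).trans (by norm_num))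
  obtain ⟨c, hcc⟩ := hnot {1, a, b, a * b} Finset.card_le_four
  simp only [Finset.mem_singleton, Finset.mem_insert, not_or] at ha hb hcc
  rcases hG.eq_or_of_commuting_involutions (h2 a ha) (h2 b hb.1) (h2 c hcc.1) (hcomm _ _)
    (hcomm _ _) (hcomm _ _) with h | h | h | h
  · exact hb.2 h.symm
  · exact hcc.2.1 h.symm
  · exact hcc.2.2.1 h.symm
  · exact hcc.2.2.2 h

theorem card_ne_sixteen : Nat.card G ≠ 16 := by
  intro hc
  have := hG.finite
  have hc' : Nat.card G = 2 ^ 4 := hc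
  obtain ⟨x, hx⟩ := hG.exists_orderOf_eq_four hc' (by norm_num)
  have hz : Nat.card (Subgroup.zpowers x) = 4 := by rw [Nat.card_zpowers, hx]
  obtain ⟨y, hy⟩ : ∃ y : G, y ∉ Subgroup.zpowers x := by
    by_contra! h
    have := (Subgroup.eq_top_iff' _).2 h
    rw [this, Subgroup.card_top] at hz
    omega
  have key : ∀ z, z ∈ Subgroup.zpowers x ∨ y * z ∈ Subgroup.zpowers x := fun z => by
    by_contra! h
    obtain ⟨h1, h2⟩ := hG.inverts_of_notMem_zpowers hc' hx hy
    obtain ⟨h3, h4⟩ := hG.inverts_of_notMem_zpowers hc' hx h.1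
    obtain ⟨h5, h6⟩ := hG.inverts_of_notMem_zpowers hc' hx h.2
    have h4' : z * x⁻¹ = x * z := by
      rw [mul_inv_eq_iff_eq_mul, mul_assoc, h4, mul_inv_cancel_left]
    have h2' : y * x⁻¹ = x * y := by
      rw [mul_inv_eq_iff_eq_mul, mul_assoc, h2, mul_inv_cancel_left]
    have h7 : y * z * x = x * (y * z) := by
      rw [mul_assoc, h4, ← mul_assoc, h2', mul_assoc]
    rw [h7, mul_left_inj] at h6
    have h8 : x ^ 2 = 1 := by
      rw [pow_two]; nth_rw 1 [h6]; exact inv_mul_cancel x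
    have := Nat.le_of_dvd (by norm_num) (orderOf_dvd_of_pow_eq_one h8)
    omega
  have hidx := (Subgroup.zpowers x).card_mul_index
  have h2 : (Subgroup.zpowers x).index = 2 := by
    refine Subgroup.index_eq_two_iff'.2 ⟨y, fun z => ?_⟩
    rcases key z with h | h
    · exact Or.inr ⟨h, fun h' => hy ((Subgroup.mul_mem_cancel_right _ h).1 h')⟩
    · exact Or.inl ⟨h, fun h' => hy ((Subgroup.mul_mem_cancel_right _ h').1 h)⟩
  rw [hz, hc] at hidx
  omega

theorem card_dvd : Nat.card G ∣ 360 := by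
  have := hG.finite
  rw [Nat.dvd_iff_prime_pow_dvd_dvd]
  intro p k hp hk
  have := Fact.mk hp
  have hno : ∀ j, p ^ j ∣ Nat.card G → ∃ K : Subgroup G, Nat.card K = p ^ j := fun j hj =>
    Sylow.exists_subgroup_card_pow_prime p hj
  have hle : ∀ j, p ^ j ∣ 360 → ¬ p ^ (j + 1) ∣ Nat.card G → p ^ k ∣ 360 := fun j h1 h2 => by
    refine (pow_dvd_pow p ?_).trans h1
    by_contra! h
    exact h2 ((pow_dvd_pow p h).trans hk)
  rcases Nat.eq_zero_or_pos k with rfl | hk0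
  · simp
  have hpd : p ∣ Nat.card G := (dvd_pow_self p hk0.ne').trans hk
  obtain ⟨x, hx⟩ := exists_prime_orderOf_dvd_card' p hpd
  have h := hG.orderOf_cases x
  rw [hx] at h
  have hp1 := hp.one_lt
  have hp4 : p ≠ 4 := fun h => by rw [h] at hp; exact absurd hp (by norm_num)
  obtain rfl | rfl | rfl : p = 2 ∨ p = 3 ∨ p = 5 := by omega
  · refine hle 3 (by norm_num) fun h => ?_
    obtain ⟨K, hK⟩ := hno _ h
    exact (hG.subgroup K).card_ne_sixteen hK
  · refine hle 2 (by norm_num) fun h => ?_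
    obtain ⟨K, hK⟩ := hno _ h
    exact (hG.subgroup K).card_ne_twentySeven hK
  · refine hle 1 (by norm_num) fun h => ?_
    obtain ⟨K, hK⟩ := hno _ h
    exact (hG.subgroup K).card_ne_twentyFive hK

end Satisfies

theorem IsPGroup.mem_sylow_of_mem_normalizer {G : Type v} [Group G] {p : ℕ} (P : Sylow p G)
    {x : G} {k : ℕ} (hx : x ^ p ^ k = 1) (h : x ∈ Subgroup.normalizer (P : Set G)) : x ∈ P := by
  have hz : IsPGroup p (Subgroup.zpowers x) := by
    rintro ⟨_, n, rfl⟩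
    refine ⟨k, Subtype.ext ?_⟩
    simp only [SubmonoidClass.coe_pow, Subgroup.coe_one]
    rw [← zpow_natCast, ← zpow_mul, mul_comm, zpow_mul, zpow_natCast, hx, one_zpow]
  have h1 : x ∈ Subgroup.zpowers x ⊓ Subgroup.normalizer (P : Set G) :=
    ⟨Subgroup.mem_zpowers x, h⟩
  rw [hz.inf_normalizer_sylow P] at h1
  exact h1.2

theorem Sylow.card_eq_of_card_eq_mul {G : Type v} [Group G] [Finite G] {p k m : ℕ}
    [hp : Fact p.Prime] (P : Sylow p G) (h : Nat.card G = p ^ k * m) (hm : ¬ p ∣ m) :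
    Nat.card P = p ^ k := by
  have hm0 : m ≠ 0 := fun h => hm (h ▸ dvd_zero p)
  rw [P.card_eq_multiplicity, h,
    Nat.factorization_mul (pow_ne_zero _ hp.out.ne_zero) hm0, hp.out.factorization_pow]
  simp [Nat.factorization_eq_zero_of_not_dvd hm]

instance Nat.fact_prime_five : Fact (Nat.Prime 5) := ⟨by norm_num⟩

namespace Satisfies

variable {G : Type v} [Group G] (hG : Satisfies G sevenFormulas)
  {p : ℕ} [Fact p.Prime] (hp : p = 3 ∨ p = 5)
include hG

include hp in
theorem orderOf_of_mem_sylow (P : Sylow p G) {x : G} (hx : x ∈ P) (h1 : x ≠ 1) :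
    orderOf x = p := by
  obtain ⟨k, hk⟩ := (IsPGroup.iff_orderOf.1 P.2) ⟨x, hx⟩
  rw [Subgroup.orderOf_mk] at hk
  have hc := hG.orderOf_cases x
  have h0 : orderOf x ≠ 1 := fun h => h1 (orderOf_eq_one_iff.1 h)
  rw [hk] at hc h0 ⊢
  rcases k with _ | _ | k
  · simp at h0
  · simp
  · have : 1 ≤ p ^ k := Nat.one_le_pow _ _ (by omega)
    rw [pow_succ, pow_succ] at hc
    exfalso
    rcases hp with rfl | rfl <;> omega

include hp in
theorem pow_eq_one_of_commute {x y : G} (hx : orderOf x = p) (h : Commute x y) : y ^ p = 1 := by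
  rw [← orderOf_dvd_iff_pow_eq_one]
  have h1 := hG.orderOf_cases y
  have h2 := hG.orderOf_cases (x * y)
  have h3 := h.orderOf_mul_eq_mul_orderOf_of_coprime
  rw [hx] at h3
  rcases hp with rfl | rfl <;> rcases h1 with h1 | h1 | h1 | h1 | h1 <;>
    first
    | (simp [h1]; done)
    | (rw [h1] at h3; rw [h3 (by norm_num)] at h2; omega)

theorem card_sylow_three (P : Sylow 3 G) : Nat.card P = 1 ∨ Nat.card P = 3 ∨ Nat.card P = 9 := by
  have := hG.finite
  obtain ⟨k, hk⟩ := IsPGroup.iff_card.1 P.2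
  have h : Nat.card P ∣ 360 := (Subgroup.card_subgroup_dvd_card _).trans hG.card_dvd
  rw [hk] at h ⊢
  rcases k with _ | _ | _ | k
  · simp
  · simp
  · simp
  · have := (pow_dvd_pow 3 (show 3 ≤ k + 1 + 1 + 1 by omega)).trans h
    omega

theorem card_sylow_five (P : Sylow 5 G) : Nat.card P = 1 ∨ Nat.card P = 5 := by
  have := hG.finite
  obtain ⟨k, hk⟩ := IsPGroup.iff_card.1 P.2
  have h : Nat.card P ∣ 360 := (Subgroup.card_subgroup_dvd_card _).trans hG.card_dvd
  rw [hk] at h ⊢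
  rcases k with _ | _ | k
  · simp
  · simp
  · have := (pow_dvd_pow 5 (show 2 ≤ k + 1 + 1 by omega)).trans h
    omega

include hp in
theorem commute_of_mem_sylow (P : Sylow p G) {x y : G} (hx : x ∈ P) (hy : y ∈ P) :
    Commute x y := by
  have := hG.finite
  have key : IsMulCommutative P := by
    rcases hp with rfl | rfl
    · rcases hG.card_sylow_three P with h | h | h
      · have : Subsingleton P := (Nat.card_eq_one_iff_unique.1 h).1
        exact ⟨⟨fun a b => Subsingleton.elim _ _⟩⟩
      · have := isCyclic_of_prime_card h
        infer_instance
      · exact IsPGroup.isMulCommutative_of_card_eq_prime_sq (p := 3) h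
    · rcases hG.card_sylow_five P with h | h
      · have : Subsingleton P := (Nat.card_eq_one_iff_unique.1 h).1
        exact ⟨⟨fun a b => Subsingleton.elim _ _⟩⟩
      · have := isCyclic_of_prime_card h
        infer_instance
  exact congrArg Subtype.val (key.is_comm.comm (⟨x, hx⟩ : P) ⟨y, hy⟩)

include hp in
theorem mem_sylow_of_commute (P : Sylow p G) {x y : G} (hx : x ∈ P) (h1 : x ≠ 1)
    (h : Commute x y) : y ∈ P := by
  have h2 : IsPGroup p (Subgroup.centralizer {x}) := fun g => ⟨1, by
    have := hG.pow_eq_one_of_commute hp (hG.orderOf_of_mem_sylow hp P hx h1)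
      (Subgroup.mem_centralizer_singleton_iff.1 g.2).symm
    rw [pow_one]
    exact Subtype.ext this⟩
  have h3 : Subgroup.centralizer {x} = P := P.is_maximal' h2 fun z hz =>
    Subgroup.mem_centralizer_singleton_iff.2 (hG.commute_of_mem_sylow hp P hz hx)
  have h4 : y ∈ (P : Subgroup G) := h3 ▸ Subgroup.mem_centralizer_singleton_iff.2 h.symm
  exact h4

include hp in
theorem sylow_eq_of_mem (P Q : Sylow p G) {x : G} (hP : x ∈ P) (hQ : x ∈ Q) (h1 : x ≠ 1) :
    P = Q := by
  ext y
  exact ⟨fun hy => hG.mem_sylow_of_commute hp Q hQ h1 (hG.commute_of_mem_sylow hp P hP hy),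
    fun hy => hG.mem_sylow_of_commute hp P hP h1 (hG.commute_of_mem_sylow hp Q hQ hy)⟩

theorem conj_ne_sq {x y : G} (hx : orderOf x = 5) : y⁻¹ * x * y ≠ x ^ 2 := by
  intro h
  have x5 : x ^ 5 = 1 := hx ▸ pow_orderOf_eq_one x
  have hpow : ∀ k : ℕ, y⁻¹ * x ^ k * y = x ^ (2 * k) := fun k => by
    rw [pow_mul, ← h]; simpa using (conj_pow (i := k) (a := y⁻¹) (b := x)).symm
  have hne : ∀ k : ℕ, ¬ 5 ∣ k → x ^ k ≠ 1 := fun k hk h' =>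
    hk (hx ▸ orderOf_dvd_of_pow_eq_one h')
  have hne12 : ∀ k : ℕ, ¬ 5 ∣ k → (x ^ k) ^ 12 ≠ 1 := fun k hk h' => by
    rw [← pow_mul] at h'
    exact hne _ (by omega) h'
  have hit : ∀ n : ℕ, x * y ^ n = y ^ n * x ^ (2 ^ n) := by
    intro n
    induction n with
    | zero => simp
    | succ n ih =>
      rw [pow_succ, ← mul_assoc, ih, mul_assoc, pow_succ, mul_comm (2 ^ n) 2, ← hpow]
      group
  have hn : ∀ n, y ^ n = 1 → 5 ∣ 2 ^ n - 1 := fun n h' => by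
    have h2 := hit n
    rw [h', mul_one, one_mul] at h2
    by_contra h3
    refine hne _ h3 ?_
    have h4 : x * x ^ (2 ^ n - 1) = x * 1 := by
      rw [← pow_succ', Nat.sub_add_cancel (Nat.one_le_two_pow), ← h2, mul_one]
    exact mul_left_cancel h4
  rcases delta6_holdsIn_iff.1 (satisfies_sevenFormulas_iff.1 hG).2.2.2.2.2.1 x y with
    h' | h' | h' | h' | h'
  · exact hne _ (by norm_num) h'
  · have := hn _ h'
    norm_num at this
  · rw [h, ← pow_succ'] at h'
    exact hne12 3 (by norm_num) h'
  · rw [hpow 3, ← pow_succ'] at h'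
    exact hne12 7 (by norm_num) h'
  · rw [h, ← pow_add] at h'
    exact hne12 4 (by norm_num) h'

include hp in
theorem conj_eq_inv_of_card_eq (P : Sylow p G) (hP : Nat.card P = p) {x g : G}
    (hx : x ∈ P) (hg : g ∈ Subgroup.normalizer (P : Set G)) (hgP : g ∉ P) :
    g * x * g⁻¹ = x⁻¹ := by
  have := hG.finite
  classical
  by_cases h1 : x = 1
  · simp [h1]
  have ho := hG.orderOf_of_mem_sylow hp P hx h1
  have hxp : x ^ p = 1 := ho ▸ pow_orderOf_eq_one x
  have hz : Subgroup.zpowers x = P :=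
    Subgroup.eq_of_le_of_card_ge (Subgroup.zpowers_le.2 hx) (by
      rw [Nat.card_zpowers, ho]; exact hP.le)
  have hmem : g * x * g⁻¹ ∈ Subgroup.zpowers x := by
    rw [hz]; exact (Subgroup.mem_normalizer_iff.1 hg x).1 hx
  obtain ⟨k, hk, hkx⟩ := (mem_zpowers_iff_mem_range_orderOf.1 hmem |> Finset.mem_image.1)
  rw [Finset.mem_range, ho] at hk
  have hnc : g * x * g⁻¹ ≠ x := fun h => hgP (hG.mem_sylow_of_commute hp P hx h1
    (mul_inv_eq_iff_eq_mul.1 h).symm)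
  have hn1 : g * x * g⁻¹ ≠ 1 := fun h => h1 (by simpa using h)
  have hlast : k + 1 = p → g * x * g⁻¹ = x⁻¹ := fun h => by
    rw [← hkx, eq_inv_iff_mul_eq_one]
    show x ^ k * x = 1
    rw [← pow_succ, h, hxp]
  rcases hp with rfl | rfl
  · interval_cases k
    · exact absurd (by simpa using hkx.symm) hn1
    · exact absurd (by simpa using hkx.symm) hnc
    · exact hlast rfl
  · interval_cases k
    · exact absurd (by simpa using hkx.symm) hn1
    · exact absurd (by simpa using hkx.symm) hnc
    · exact absurd (by simpa using hkx.symm) (hG.conj_ne_sq (y := g⁻¹) ho)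
    · exfalso
      refine hG.conj_ne_sq (y := g) (x := x) ho ?_
      have h3 : g * x * g⁻¹ = x ^ 3 := hkx.symm
      have h6 : g * x ^ 2 * g⁻¹ = x := by
        rw [← conj_pow, h3, ← pow_mul, show 3 * 2 = 5 + 1 by norm_num, pow_add, hxp]
        simp
      have h7 : x = g * x ^ 2 * g⁻¹ := h6.symm
      calc g⁻¹ * x * g = g⁻¹ * (g * x ^ 2 * g⁻¹) * g := by rw [← h7]
        _ = x ^ 2 := by group
    · exact hlast rfl

include hp in
theorem card_normalizer_of_card_eq (P : Sylow p G) (hP : Nat.card P = p) :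
    Nat.card (Subgroup.normalizer (P : Set G)) = p ∨
      Nat.card (Subgroup.normalizer (P : Set G)) = 2 * p := by
  have := hG.finite
  have hle : (P : Subgroup G) ≤ Subgroup.normalizer (P : Set G) := Subgroup.le_normalizer
  have hc := Subgroup.card_mul_index ((P : Subgroup G).subgroupOf (Subgroup.normalizer (P : Set G)))
  rw [Nat.card_congr (Subgroup.subgroupOfEquivOfLe hle).toEquiv] at hc
  change Nat.card P * (P : Subgroup G).relIndex _ = _ at hc
  rw [hP] at hc
  by_cases h : ∃ g ∈ Subgroup.normalizer (P : Set G), g ∉ P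
  · obtain ⟨g, hg, hgP⟩ := h
    right
    have h2 : (P : Subgroup G).relIndex (Subgroup.normalizer (P : Set G)) = 2 := by
      rw [Subgroup.relIndex_eq_two_iff_exists_notMem_and]
      refine ⟨g, hg, hgP, fun b hb => ?_⟩
      by_contra! hb'
      have : Nontrivial P := Finite.one_lt_card_iff_nontrivial.1 (by
        rw [hP]; exact (Fact.out : p.Prime).one_lt)
      obtain ⟨⟨x, hx⟩, hx1⟩ := exists_ne (1 : P)
      have hx1' : x ≠ 1 := fun h => hx1 (Subtype.ext h)
      refine hb'.1 (hG.mem_sylow_of_commute hp P hx hx1' ?_)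
      have e1 := hG.conj_eq_inv_of_card_eq hp P hP hx hg hgP
      have e2 := hG.conj_eq_inv_of_card_eq hp P hP (inv_mem hx) hb hb'.2
      have e3 : b * g * x * (b * g)⁻¹ = x := by
        calc b * g * x * (b * g)⁻¹ = b * (g * x * g⁻¹) * b⁻¹ := by group
          _ = x := by rw [e1, e2, inv_inv]
      exact (mul_inv_eq_iff_eq_mul.1 e3).symm
    rw [← hc, h2, mul_comm]
  · push Not at h
    left
    have h1 : Subgroup.normalizer (P : Set G) = P := le_antisymm h hle
    rw [h1]; exact hP

include hp in
theorem card_sylow_mul_le (q : ℕ) (hq : ∀ P : Sylow p G, Nat.card P = q + 1) :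
    Nat.card (Sylow p G) * q ≤ Nat.card {g : G // orderOf g = p} := by
  have := hG.finite
  have h1 : ∀ P : Sylow p G, Nat.card {x : P // x ≠ 1} = q := fun P => by
    have : Fintype P := Fintype.ofFinite P
    classical
    have h : Nat.card {x // x ∈ P} = q + 1 := hq P
    rw [Nat.card_eq_fintype_card] at h
    rw [Nat.card_eq_fintype_card, Fintype.card_subtype_compl, h]
    simp
  let ε : ∀ P : Sylow p G, Fin q ≃ {x : P // x ≠ 1} := fun P =>
    (Finite.equivFinOfCardEq (h1 P)).symm
  have hne : ∀ (P : Sylow p G) i, ((ε P i : P) : G) ≠ 1 := fun P i h =>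
    (ε P i).2 (Subtype.ext h)
  have h2 : Nat.card (Sylow p G × Fin q) = Nat.card (Sylow p G) * q := by
    rw [Nat.card_prod, Nat.card_fin]
  rw [← h2]
  refine Nat.card_le_card_of_injective (fun a => ⟨((ε a.1 a.2 : a.1) : G),
    hG.orderOf_of_mem_sylow hp a.1 (ε a.1 a.2 : a.1).2 (hne _ _)⟩) ?_
  rintro ⟨P, i⟩ ⟨Q, j⟩ h
  have h : ((ε P i : P) : G) = ((ε Q j : Q) : G) := congrArg Subtype.val h
  obtain rfl : P = Q := hG.sylow_eq_of_mem hp P Q (ε P i : P).2 (h ▸ (ε Q j : Q).2) (hne _ _)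
  rw [SetLike.coe_eq_coe, ← Subtype.ext_iff, (ε P).apply_eq_iff_eq] at h
  rw [h]

theorem card_orderOf_three_add_five :
    Nat.card {g : G // orderOf g = 3} + Nat.card {g : G // orderOf g = 5} + 1 ≤ Nat.card G := by
  have := hG.finite
  have : Fintype G := Fintype.ofFinite G
  classical
  simp only [Nat.card_eq_fintype_card, Fintype.card_subtype]
  rw [← Finset.card_union_of_disjoint, ← Finset.card_singleton (1 : G),
    ← Finset.card_union_of_disjoint]
  · exact Finset.card_le_univ _
  · rw [Finset.disjoint_singleton_right]; simp
  · rw [Finset.disjoint_filter]; intro g _ h; omega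

end Satisfies

namespace Satisfies

variable {G : Type v} [Group G] (hG : Satisfies G sevenFormulas)
  {p : ℕ} [Fact p.Prime] (hp : p = 3 ∨ p = 5)
include hG

include hp in
theorem involution_conj_eq_inv (P : Sylow p G) {t x : G} (ht : orderOf t = 2)
    (htN : t ∈ Subgroup.normalizer (P : Set G)) (hx : x ∈ P) : t * x * t⁻¹ = x⁻¹ := by
  have t2 : t * t = 1 := by rw [← pow_two, ← ht, pow_orderOf_eq_one]
  have hy : t * x * t⁻¹ ∈ P := (Subgroup.mem_normalizer_iff.1 htN x).1 hx
  have hc := hG.commute_of_mem_sylow hp P hx hy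
  have hu : x * (t * x * t⁻¹) ∈ P := mul_mem hx hy
  by_cases h1 : x * (t * x * t⁻¹) = 1
  · exact (inv_eq_of_mul_eq_one_right h1).symm
  exfalso
  have h2 : t ∈ P := by
    refine hG.mem_sylow_of_commute hp P hu h1 (mul_inv_eq_iff_eq_mul.1 ?_).symm
    have hinv : t⁻¹ = t := inv_eq_of_mul_eq_one_right t2
    calc t * (x * (t * x * t⁻¹)) * t⁻¹ = (t * x * t⁻¹) * ((t * t) * x * (t⁻¹ * t⁻¹)) := by group
      _ = (t * x * t⁻¹) * x := by rw [hinv, t2]; simp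
      _ = x * (t * x * t⁻¹) := hc.eq.symm
  have h3 := hG.orderOf_of_mem_sylow hp P h2 (fun h => by simp [h] at ht)
  omega

include hp in
theorem involution_unique (P : Sylow p G) {x t u : G} (hx : x ∈ P) (hx1 : x ≠ 1)
    (ht : orderOf t = 2) (hu : orderOf u = 2) (htN : t ∈ Subgroup.normalizer (P : Set G))
    (huN : u ∈ Subgroup.normalizer (P : Set G)) (h : Commute t u) : t = u := by
  have t2 : t ^ 2 = 1 := ht ▸ pow_orderOf_eq_one t
  have u2 : u ^ 2 = 1 := hu ▸ pow_orderOf_eq_one u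
  have h1 : t * u ∈ P := by
    refine hG.mem_sylow_of_commute hp P hx hx1 (mul_inv_eq_iff_eq_mul.1 ?_).symm
    calc t * u * x * (t * u)⁻¹ = t * (u * x * u⁻¹) * t⁻¹ := by group
      _ = x := by
        rw [hG.involution_conj_eq_inv hp P hu huN hx,
          hG.involution_conj_eq_inv hp P ht htN (inv_mem hx), inv_inv]
  by_contra hne
  have h2 : t * u ≠ 1 := fun h' => hne (by
    rw [mul_eq_one_iff_eq_inv.1 h', inv_eq_iff_mul_eq_one, ← pow_two, u2])
  have h3 := hG.orderOf_of_mem_sylow hp P h1 h2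
  have h4 : (t * u) ^ 2 = 1 := by rw [h.mul_pow, t2, u2, one_mul]
  have h5 := orderOf_dvd_of_pow_eq_one h4
  rw [h3] at h5
  rcases hp with rfl | rfl <;> omega

omit hG [Fact p.Prime] in
theorem _root_.Sylow.exists_mem_ne_one (P : Sylow p G) (h : Nat.card P ≠ 1) :
    ∃ x ∈ P, x ≠ 1 := by
  by_contra! h1
  exact h (by rw [(Subgroup.eq_bot_iff_forall (P : Subgroup G)).2 h1]; exact Subgroup.card_bot)

theorem not_eight_dvd_card_normalizer (P : Sylow 3 G) (hP : Nat.card P ≠ 1) :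
    ¬ 8 ∣ Nat.card (Subgroup.normalizer (P : Set G)) := by
  intro h
  have := hG.finite
  obtain ⟨S, hS⟩ := Sylow.exists_subgroup_card_pow_prime
    (G := Subgroup.normalizer (P : Set G)) 2 (n := 3) (by simpa using h)
  obtain ⟨e, he, he1⟩ := P.exists_mem_ne_one hP
  have hGS := (hG.subgroup (Subgroup.normalizer (P : Set G))).subgroup S
  obtain ⟨x, hx⟩ := hGS.exists_orderOf_eq_four hS le_rfl
  obtain ⟨y, hy⟩ : ∃ y : S, y ∉ Subgroup.zpowers x := by
    by_contra! h
    have hz : Nat.card (Subgroup.zpowers x) = 4 := by rw [Nat.card_zpowers, hx]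
    rw [(Subgroup.eq_top_iff' _).2 h, Subgroup.card_top, hS] at hz
    omega
  obtain ⟨h2, h3⟩ := hGS.inverts_of_notMem_zpowers hS hx hy
  have hx2 : orderOf (x ^ 2) = 2 := by rw [orderOf_pow, hx]; rfl
  have hc : Commute (x ^ 2) y := by
    have h4 : SemiconjBy y x x⁻¹ := h3
    have h5 := h4.pow_right 2
    have h6 : x⁻¹ ^ 2 = x ^ 2 := by
      rw [inv_pow, inv_eq_iff_mul_eq_one, ← pow_add]; exact orderOf_dvd_iff_pow_eq_one.1 (hx ▸ dvd_rfl)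
    rw [h6] at h5
    exact h5.symm
  have key := hG.involution_unique (Or.inl rfl) P (t := ((x ^ 2 : S) : G)) (u := (y : G)) he he1
    (by rw [Subgroup.orderOf_coe, Subgroup.orderOf_coe, hx2])
    (by rw [Subgroup.orderOf_coe, Subgroup.orderOf_coe, h2])
    (x ^ 2 : S).1.2 y.1.2 (congrArg (fun z : S => ((z : Subgroup.normalizer (P : Set G)) : G)) hc)
  have key' : x ^ 2 = y := Subtype.ext (Subtype.ext key)
  exact hy (key' ▸ pow_mem (Subgroup.mem_zpowers x) 2)

theorem not_five_dvd_card_normalizer (P : Sylow 3 G) (hP : Nat.card P = 9) :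
    ¬ 5 ∣ Nat.card (Subgroup.normalizer (P : Set G)) := by
  intro h
  have := hG.finite
  obtain ⟨g, hg⟩ := exists_prime_orderOf_dvd_card' 5 h
  let N := Subgroup.normalizer (P : Set G)
  let Z := Subgroup.zpowers g
  let act : Z →* MulAut (P : Subgroup G) :=
    ((P : Subgroup G).normalizerMonoidHom).comp Z.subtype
  let _ : MulAction Z (P : Subgroup G) := MulAction.compHom _ act
  have hZ : IsPGroup 5 Z := IsPGroup.of_card (n := 1) (by rw [Nat.card_zpowers, hg, pow_one])
  have hmod := hZ.card_modEq_card_fixedPoints (P : Subgroup G)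
  change Nat.card P ≡ _ [MOD 5] at hmod
  rw [hP] at hmod
  have hex : ∃ x : (P : Subgroup G), x ∈ MulAction.fixedPoints Z (P : Subgroup G) ∧ x ≠ 1 := by
    by_contra! h'
    have : Nat.card (MulAction.fixedPoints Z (P : Subgroup G)) ≤ 1 := by
      rw [Finite.card_le_one_iff_subsingleton]
      exact ⟨fun a b => Subtype.ext ((h' a a.2).trans (h' b b.2).symm)⟩
    unfold Nat.ModEq at hmod
    omega
  obtain ⟨x, hx, hx1⟩ := hex
  have h1 : ((g : G) * x * (g : G)⁻¹) = x :=
    congrArg Subtype.val (hx ⟨g, Subgroup.mem_zpowers g⟩)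
  have h2 : (g : G) ∈ P := hG.mem_sylow_of_commute (Or.inl rfl) P x.2
    (fun h => hx1 (Subtype.ext h)) (mul_inv_eq_iff_eq_mul.1 h1).symm
  have h3 := hG.orderOf_of_mem_sylow (Or.inl rfl) P h2 (fun h => by
    have : g = 1 := Subtype.ext h
    rw [this, orderOf_one] at hg; omega)
  rw [Subgroup.orderOf_coe, hg] at h3
  omega

theorem card_cases : Nat.card G ∈ Nat.divisors 360 :=
  Nat.mem_divisors.2 ⟨hG.card_dvd, by norm_num⟩

omit hG in
theorem _root_.Nat.eq_of_mem_divisors_360 : ∀ n ∈ Nat.divisors 360, n = 1 ∨ n = 2 ∨ n = 3 ∨ n = 4 ∨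
    n = 5 ∨ n = 6 ∨ n = 8 ∨ n = 9 ∨ n = 10 ∨ n = 12 ∨ n = 15 ∨ n = 18 ∨ n = 20 ∨ n = 24 ∨ n = 30 ∨
    n = 36 ∨ n = 40 ∨ n = 45 ∨ n = 60 ∨ n = 72 ∨ n = 90 ∨ n = 120 ∨ n = 180 ∨ n = 360 := by
  decide +kernel

theorem card_normalizer_of_card_eq_nine (P : Sylow 3 G) (hP : Nat.card P = 9) :
    Nat.card (Subgroup.normalizer (P : Set G)) = 9 ∨
    Nat.card (Subgroup.normalizer (P : Set G)) = 18 ∨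
    Nat.card (Subgroup.normalizer (P : Set G)) = 36 := by
  have h1 : Nat.card P ∣ Nat.card (Subgroup.normalizer (P : Set G)) :=
    Subgroup.card_dvd_of_le Subgroup.le_normalizer
  rw [hP] at h1
  have h2 := hG.not_eight_dvd_card_normalizer P (by omega)
  have h3 := hG.not_five_dvd_card_normalizer P hP
  have h4 := Nat.eq_of_mem_divisors_360 _ (hG.subgroup (Subgroup.normalizer (P : Set G))).card_cases
  omega

omit hG in
theorem _root_.Sylow.card_mul_card_normalizer [Finite G] (P : Sylow p G) :
    Nat.card (Sylow p G) * Nat.card (Subgroup.normalizer (P : Set G)) = Nat.card G := by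
  rw [P.card_eq_index_normalizer, Subgroup.index_mul_card]

include hp in
theorem smul_sylow_injective (P Q : Sylow p G) (h : P ≠ Q) :
    Function.Injective fun x : P => (x : G) • Q := by
  intro x y hxy
  have h1 : ((y : G)⁻¹ * x) • Q = Q := by
    rw [mul_smul, inv_smul_eq_iff]; exact hxy
  have hm : (y : G)⁻¹ * x ∈ P := mul_mem (inv_mem y.2) x.2
  by_contra hne
  have hne' : (y : G)⁻¹ * x ≠ 1 := fun h => hne (Subtype.ext (inv_mul_eq_one.1 h).symm)
  have h2 : (y : G)⁻¹ * x ∈ Q := by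
    refine IsPGroup.mem_sylow_of_mem_normalizer Q (k := 1) ?_ (Sylow.smul_eq_iff_mem_normalizer.1 h1)
    have := pow_orderOf_eq_one ((y : G)⁻¹ * x)
    rw [hG.orderOf_of_mem_sylow hp P hm hne'] at this
    rwa [pow_one]
  exact h (hG.sylow_eq_of_mem hp P Q hm h2 hne')

omit hG [Fact p.Prime] in
theorem _root_.Sylow.smul_ne_of_mem (P Q : Sylow p G) (h : P ≠ Q) (x : P) :
    (x : G) • Q ≠ P := fun hx => h <| by
  rw [smul_eq_iff_eq_inv_smul] at hx
  rw [hx, eq_comm, Sylow.smul_eq_iff_mem_normalizer]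
  exact Subgroup.le_normalizer (inv_mem x.2)

theorem card_sylow_eq_one_or_ten_le (P : Sylow 3 G) (hP : Nat.card P = 9) :
    Nat.card (Sylow 3 G) = 1 ∨ 10 ≤ Nat.card (Sylow 3 G) := by
  have := hG.finite
  by_cases h : ∃ Q : Sylow 3 G, P ≠ Q
  · right
    obtain ⟨Q, hQ⟩ := h
    have h1 : Nat.card (Option P) = 10 := by
      rw [Finite.card_option]; exact congrArg (· + 1) hP
    rw [← h1]
    refine Nat.card_le_card_of_injective (fun o => o.elim P fun x => (x : G) • Q) ?_
    rintro (_ | x) (_ | y) hxy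
    · rfl
    · exact absurd hxy.symm (P.smul_ne_of_mem Q hQ y)
    · exact absurd hxy (P.smul_ne_of_mem Q hQ x)
    · exact congrArg some (hG.smul_sylow_injective (Or.inl rfl) P Q hQ hxy)
  · push Not at h
    left
    exact Nat.card_eq_one_iff_unique.2 ⟨⟨fun a b => (h a).symm.trans (h b)⟩, ⟨P⟩⟩

theorem card_sylow_three_mod : Nat.card (Sylow 3 G) % 3 = 1 := by
  have := hG.finite
  exact card_sylow_modEq_one 3 G

theorem card_sylow_five_mod : Nat.card (Sylow 5 G) % 5 = 1 := by
  have := hG.finite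
  exact card_sylow_modEq_one 5 G

theorem card_sylow_of_five_dvd (h : 5 ∣ Nat.card G) :
    (Nat.card (Sylow 5 G) * 5 = Nat.card G ∨ Nat.card (Sylow 5 G) * 10 = Nat.card G) ∧
      Nat.card (Sylow 5 G) * 4 ≤ Nat.card {g : G // orderOf g = 5} := by
  have := hG.finite
  have hc : ∀ P : Sylow 5 G, Nat.card P = 5 := fun P => by
    rcases hG.card_sylow_five P with h1 | h1
    · exfalso
      have := P.dvd_card_of_dvd_card h
      change 5 ∣ Nat.card P at this
      omega
    · exact h1
  let P : Sylow 5 G := default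
  refine ⟨?_, hG.card_sylow_mul_le (Or.inr rfl) 4 hc⟩
  rw [← P.card_mul_card_normalizer]
  rcases hG.card_normalizer_of_card_eq (Or.inr rfl) P (hc P) with h1 | h1 <;> rw [h1] <;> simp

theorem card_sylow_of_three_dvd (h : 3 ∣ Nat.card G) (h9 : ¬ 9 ∣ Nat.card G) :
    (Nat.card (Sylow 3 G) * 3 = Nat.card G ∨ Nat.card (Sylow 3 G) * 6 = Nat.card G) ∧
      Nat.card (Sylow 3 G) * 2 ≤ Nat.card {g : G // orderOf g = 3} := by
  have := hG.finite
  have hc : ∀ P : Sylow 3 G, Nat.card P = 3 := fun P => by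
    have h2 := P.dvd_card_of_dvd_card h
    have h3 : Nat.card P ∣ Nat.card G := Subgroup.card_subgroup_dvd_card _
    change 3 ∣ Nat.card P at h2
    rcases hG.card_sylow_three P with h1 | h1 | h1
    · omega
    · exact h1
    · rw [h1] at h3; exact absurd h3 h9
  let P : Sylow 3 G := default
  refine ⟨?_, hG.card_sylow_mul_le (Or.inl rfl) 2 hc⟩
  rw [← P.card_mul_card_normalizer]
  rcases hG.card_normalizer_of_card_eq (Or.inl rfl) P (hc P) with h1 | h1 <;> rw [h1] <;> simp

theorem card_sylow_eq_nine (h : 9 ∣ Nat.card G) (P : Sylow 3 G) : Nat.card P = 9 := by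
  have := hG.finite
  obtain ⟨m, hm⟩ := h
  refine P.card_eq_of_card_eq_mul (k := 2) hm fun h3 => ?_
  have := hG.card_dvd
  rw [hm] at this
  have h27 : 9 * 3 ∣ 360 := (Nat.mul_dvd_mul_left 9 h3).trans this
  omega

theorem card_sylow_of_nine_dvd (h : 9 ∣ Nat.card G) :
    (Nat.card (Sylow 3 G) * 9 = Nat.card G ∨ Nat.card (Sylow 3 G) * 18 = Nat.card G ∨
      Nat.card (Sylow 3 G) * 36 = Nat.card G) ∧
      Nat.card (Sylow 3 G) * 8 ≤ Nat.card {g : G // orderOf g = 3} ∧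
      (Nat.card (Sylow 3 G) = 1 ∨ 10 ≤ Nat.card (Sylow 3 G)) := by
  have := hG.finite
  let P : Sylow 3 G := default
  refine ⟨?_, hG.card_sylow_mul_le (Or.inl rfl) 8 (hG.card_sylow_eq_nine h),
    hG.card_sylow_eq_one_or_ten_le P (hG.card_sylow_eq_nine h P)⟩
  rw [← P.card_mul_card_normalizer]
  rcases hG.card_normalizer_of_card_eq_nine P (hG.card_sylow_eq_nine h P) with h1 | h1 | h1 <;>
    rw [h1] <;> simp

theorem card_of_five_dvd (h : 5 ∣ Nat.card G) : Nat.card G = 5 ∨ Nat.card G = 10 ∨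
    Nat.card G = 60 ∨ (Nat.card G = 360 ∧ Nat.card (Sylow 3 G) = 10) := by
  obtain ⟨h1, h2⟩ := hG.card_sylow_of_five_dvd h
  have h3 := hG.card_sylow_five_mod
  have h4 := hG.card_sylow_three_mod
  have h5 := hG.card_orderOf_three_add_five
  have h6 := hG.card_sylow_of_three_dvd
  have h7 := hG.card_sylow_of_nine_dvd
  rcases Nat.eq_of_mem_divisors_360 _ hG.card_cases with hc | hc | hc | hc | hc | hc | hc | hc |
    hc | hc | hc | hc | hc | hc | hc | hc | hc | hc | hc | hc | hc | hc | hc | hc <;>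
  rw [hc] at h h1 h5 h6 h7 ⊢ <;> omega

theorem card_of_not_five_dvd (h : ¬ 5 ∣ Nat.card G) :
    (Nat.card G ≤ 4) ∨ Nat.card G = 6 ∨ Nat.card G = 8 ∨
    (Nat.card G = 12 ∧ Nat.card (Sylow 3 G) = 4) ∨ (Nat.card G = 24 ∧ Nat.card (Sylow 3 G) = 4) ∨
    ((Nat.card G = 9 ∨ Nat.card G = 18 ∨ Nat.card G = 36) ∧ Nat.card (Sylow 3 G) = 1) := by
  have h4 := hG.card_sylow_three_mod
  have h6 := hG.card_sylow_of_three_dvd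
  have h7 := hG.card_sylow_of_nine_dvd
  rcases Nat.eq_of_mem_divisors_360 _ hG.card_cases with hc | hc | hc | hc | hc | hc | hc | hc |
    hc | hc | hc | hc | hc | hc | hc | hc | hc | hc | hc | hc | hc | hc | hc | hc <;>
  rw [hc] at h h6 h7 ⊢ <;> omega

end Satisfies

/-- The alternating group of degree `6`. -/
local notation "A₆" => alternatingGroup (Fin 6)

theorem isSection_of_even {G : Type v} [Group G] {X : Type*} [Fintype X] [DecidableEq X]
    (hX : Fintype.card X ≤ 6) (φ : G →* Equiv.Perm X) (hφ : Function.Injective φ)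
    (hs : ∀ g, Equiv.Perm.sign (φ g) = 1) : IsSection G A₆ := by
  classical
  obtain ⟨f⟩ := Function.Embedding.nonempty_of_card_le (α := X) (β := Fin 6) (by simpa using hX)
  let ε : X ≃ {y : Fin 6 // y ∈ Set.range f} := Equiv.ofInjective f f.injective
  let ψ : Equiv.Perm X →* Equiv.Perm (Fin 6) := Equiv.Perm.extendDomainHom ε
  refine isSection_of_injective ((ψ.comp φ).codRestrict A₆ fun g => ?_) ?_
  · rw [Equiv.Perm.mem_alternatingGroup]
    show Equiv.Perm.sign ((φ g).extendDomain ε) = 1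
    rw [Equiv.Perm.sign_extendDomain, hs]
  · rw [MonoidHom.injective_codRestrict]
    exact (Equiv.Perm.extendDomainHom_injective ε).comp hφ

theorem isSection_of_perm {G : Type v} [Group G] {X : Type*} [Finite X]
    (hX : Nat.card X ≤ 4) (φ : G →* Equiv.Perm X) (hφ : Function.Injective φ) :
    IsSection G A₆ := by
  classical
  have : Fintype X := Fintype.ofFinite X
  let σ : G →* Equiv.Perm ℤˣ := (MulAction.toPermHom ℤˣ ℤˣ).comp (Equiv.Perm.sign.comp φ)
  refine isSection_of_even (X := X ⊕ ℤˣ) ?_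
    ((Equiv.Perm.sumCongrHom X ℤˣ).comp (φ.prod σ)) ?_ fun g => ?_
  · rw [Nat.card_eq_fintype_card] at hX
    simp only [Fintype.card_sum, Fintype.card_units_int]
    omega
  · refine Equiv.Perm.sumCongrHom_injective.comp fun a b hab => hφ ?_
    exact congrArg Prod.fst hab
  · have h : ∀ u : ℤˣ, Equiv.Perm.sign (MulAction.toPermHom ℤˣ ℤˣ u) = u := by decide
    show Equiv.Perm.sign (Equiv.Perm.sumCongr (φ g) (σ g)) = 1
    rw [Equiv.Perm.sign_sumCongr]
    show _ * Equiv.Perm.sign (MulAction.toPermHom ℤˣ ℤˣ (Equiv.Perm.sign (φ g))) = 1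
    rw [h]
    exact Int.units_mul_self _

theorem isSection_of_noncentral_involution {G : Type v} [Group G] [Finite G] {t g : G}
    (ht : orderOf t = 2) (h : ¬ Commute t g) (hc : Nat.card G ≤ 8) : IsSection G A₆ := by
  have hz : Nat.card (Subgroup.zpowers t) = 2 := by rw [Nat.card_zpowers, ht]
  have hi := (Subgroup.zpowers t).card_mul_index
  rw [hz, Subgroup.index_eq_card] at hi
  refine isSection_of_perm (X := G ⧸ Subgroup.zpowers t) (by omega)
    (MulAction.toPermHom G _) ?_
  rw [← MonoidHom.ker_eq_bot_iff, ← Subgroup.normalCore_eq_ker, Subgroup.eq_bot_iff_forall]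
  intro x hx
  have hz : ∀ y ∈ Subgroup.zpowers t, y = 1 ∨ y = t := by
    classical
    intro y hy
    obtain ⟨k, hk, rfl⟩ := Finset.mem_image.1 (mem_zpowers_iff_mem_range_orderOf.1 hy)
    rw [Finset.mem_range, ht] at hk
    interval_cases k <;> simp
  have hxt : x ∈ Subgroup.zpowers t := Subgroup.normalCore_le _ hx
  rcases hz x hxt with h1 | rfl
  · exact h1
  · exfalso
    have h2 := Subgroup.normalCore_le _ ((Subgroup.normalCore_normal _).conj_mem x hx g)
    rcases hz _ h2 with h3 | h3
    · have : x = 1 := by simpa using h3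
      simp [this] at ht
    · exact h (mul_inv_eq_iff_eq_mul.1 h3).symm

theorem exists_injective_of_normalForm {G G' : Type*} [Group G] [Group G'] [Finite G] [Finite G']
    {ι F : Type*} (s : ι → G) (s' : ι → G') (ν : F → G) (ν' : F → G') (f₀ : F) (h0 : ν f₀ = 1)
    (h0' : ν' f₀ = 1) (τ : ι → F → F) (hτ : ∀ i f, s i * ν f = ν (τ i f))
    (hτ' : ∀ i f, s' i * ν' f = ν' (τ i f)) (hs : Subgroup.closure (Set.range s) = ⊤)
    (hν : ∀ f, ν f = 1 ↔ ν' f = 1) : ∃ φ : G →* G', Function.Injective φ := by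
  let S : Set (G × G') := Set.range fun i => (s i, s' i)
  let D : Subgroup (G × G') := Subgroup.closure S
  have hD : ∀ d ∈ D, ∃ f, d = (ν f, ν' f) := by
    intro d hd
    have hd' : d ∈ Submonoid.closure S := by
      rw [← Subgroup.closure_toSubmonoid_of_finite (s := S)]; exact hd
    induction hd' using Submonoid.closure_induction_left with
    | one => exact ⟨f₀, by rw [h0, h0']; rfl⟩
    | mul_left x hx y hy ih =>
      obtain ⟨i, rfl⟩ := hx
      have hy' : y ∈ D := by
        have := Subgroup.closure_toSubmonoid_of_finite (s := S)
        rw [← this] at hy; exact hy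
      obtain ⟨f, rfl⟩ := ih hy'
      exact ⟨τ i f, by rw [← hτ, ← hτ']; rfl⟩
  let π : D →* G := (MonoidHom.fst G G').comp D.subtype
  have hπ : Function.Bijective π := by
    constructor
    · rw [injective_iff_map_eq_one]
      rintro ⟨d, hd⟩ h
      obtain ⟨f, rfl⟩ := hD d hd
      have h : ν f = 1 := h
      exact Subtype.ext (Prod.ext h ((hν f).1 h))
    · rw [← MonoidHom.range_eq_top, eq_top_iff, ← hs, Subgroup.closure_le]
      rintro _ ⟨i, rfl⟩
      exact ⟨⟨(s i, s' i), Subgroup.subset_closure ⟨i, rfl⟩⟩, rfl⟩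
  let ε : D ≃* G := MulEquiv.ofBijective π hπ
  suffices h2 : Function.Injective ((MonoidHom.snd G G').comp D.subtype) from
     ⟨((MonoidHom.snd G G').comp D.subtype).comp ε.symm.toMonoidHom,
      h2.comp ε.symm.injective⟩
  rw [injective_iff_map_eq_one]
  rintro ⟨d, hd⟩ h
  obtain ⟨f, rfl⟩ := hD d hd
  have h : ν' f = 1 := h
  exact Subtype.ext (Prod.ext ((hν f).2 h) h)

theorem exists_injective_of_semidirect {G G' V : Type*} [Group G] [Group G'] [Finite G] [Finite G']
    [AddCommGroup V] [Finite V] (e : Multiplicative V →* G) (e' : Multiplicative V →* G') (h : G)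
    (h' : G') (k : ℕ) (hk : 0 < k) (hh : h ^ k = 1) (hh' : h' ^ k = 1) (m : V → V)
    (hm : ∀ v, h * e (.ofAdd v) = e (.ofAdd (m v)) * h)
    (hm' : ∀ v, h' * e' (.ofAdd v) = e' (.ofAdd (m v)) * h')
    (hi : ∀ v, ∀ c < k, e (.ofAdd v) * h ^ c = 1 → v = 0 ∧ c = 0)
    (hi' : ∀ v, ∀ c < k, e' (.ofAdd v) * h' ^ c = 1 → v = 0 ∧ c = 0)
    (hc : Nat.card G = Nat.card V * k) : ∃ φ : G →* G', Function.Injective φ := by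
  have : NeZero k := ⟨hk.ne'⟩
  have hmod : ∀ c : ℕ, h ^ (c % k) = h ^ c := fun c => (pow_eq_pow_mod c hh).symm
  have hmod' : ∀ c : ℕ, h' ^ (c % k) = h' ^ c := fun c => (pow_eq_pow_mod c hh').symm
  let ν : V × Fin k → G := fun f => e (.ofAdd f.1) * h ^ (f.2 : ℕ)
  have hinj : Function.Injective ν := by
    have key : ∀ v w : V, ∀ c d : ℕ, c ≤ d → d < k →
        e (.ofAdd v) * h ^ c = e (.ofAdd w) * h ^ d → v = w ∧ c = d := by
      intro v w c d hcd hd heq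
      have h1 : e (.ofAdd (w - v)) * h ^ (d - c) = 1 := by
        have h2 : h ^ d = h ^ (d - c) * h ^ c := by rw [← pow_add, Nat.sub_add_cancel hcd]
        rw [h2, ← mul_assoc, ← eq_mul_inv_iff_mul_eq, mul_assoc, mul_inv_cancel, mul_one] at heq
        rw [sub_eq_neg_add, ofAdd_add, map_mul, ofAdd_neg, map_inv, mul_assoc, inv_mul_eq_one]
        exact heq
      obtain ⟨h3, h4⟩ := hi _ _ (by omega) h1
      exact ⟨(sub_eq_zero.1 h3).symm, by omega⟩
    rintro ⟨v, c⟩ ⟨w, d⟩ heq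
    rcases le_total (c : ℕ) d with hcd | hcd
    · obtain ⟨h1, h2⟩ := key v w c d hcd d.2 heq
      exact Prod.ext h1 (Fin.ext h2)
    · obtain ⟨h1, h2⟩ := key w v d c hcd c.2 heq.symm
      exact Prod.ext h1.symm (Fin.ext h2.symm)
  have hsurj : Function.Surjective ν := by
    have : Function.Bijective ν := (Nat.bijective_iff_injective_and_card ν).2
      ⟨hinj, by rw [hc, Nat.card_prod, Nat.card_fin]⟩
    exact this.2
  refine exists_injective_of_normalForm (ι := Option V) (F := V × Fin k)
    (fun o => o.elim h fun v => e (.ofAdd v)) (fun o => o.elim h' fun v => e' (.ofAdd v))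
    ν (fun f => e' (.ofAdd f.1) * h' ^ (f.2 : ℕ)) (0, 0) (by simp [ν]) (by simp)
    (fun o f => o.elim (m f.1, f.2 + 1) fun v => (v + f.1, f.2)) ?_ ?_ ?_ ?_
  · rintro (_ | v) ⟨w, c⟩
    · simp only [Option.elim_none, ν, Fin.val_add, hmod]
      rw [← mul_assoc, hm, mul_assoc, pow_add, Fin.val_one', hmod, pow_one, ← pow_succ', pow_succ]
    · simp [ν, mul_assoc]
  · rintro (_ | v) ⟨w, c⟩
    · simp only [Option.elim_none, Fin.val_add, hmod']
      rw [← mul_assoc, hm', mul_assoc, pow_add, Fin.val_one', hmod', pow_one, ← pow_succ', pow_succ]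
    · simp [mul_assoc]
  · rw [Subgroup.eq_top_iff']
    intro g
    obtain ⟨⟨v, c⟩, rfl⟩ := hsurj g
    have h1 : h ∈ Set.range fun o : Option V => o.elim h fun v => e (.ofAdd v) := ⟨none, rfl⟩
    exact mul_mem (Subgroup.subset_closure ⟨some v, rfl⟩)
      (pow_mem (Subgroup.subset_closure h1) _)
  · rintro ⟨v, c⟩
    constructor
    · intro h1
      obtain ⟨rfl, h2⟩ := hi v c c.2 h1
      simp [h2]
    · intro h1
      obtain ⟨rfl, h2⟩ := hi' v c c.2 h1
      simp [ν, h2]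

/-- The homomorphism `a ↦ x ^ a` of `ℤ/n` when `xⁿ = 1`. -/
def zmodPowHom {G : Type*} [Group G] (n : ℕ) [NeZero n] (x : G) (hx : x ^ n = 1) :
    Multiplicative (ZMod n) →* G where
  toFun a := x ^ (Multiplicative.toAdd a).val
  map_one' := by simp
  map_mul' a b := by rw [toAdd_mul, ZMod.val_add, ← pow_eq_pow_mod _ hx, pow_add]

/-- The homomorphism `(a, b) ↦ x ^ a y ^ b` of `ℤ/n × ℤ/n` when `xⁿ = yⁿ = 1` and `xy = yx`. -/
def zmodPowHom₂ {G : Type*} [Group G] (n : ℕ) [NeZero n] (x y : G) (hx : x ^ n = 1)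
    (hy : y ^ n = 1) (h : Commute x y) : Multiplicative (ZMod n × ZMod n) →* G where
  toFun a := x ^ (Multiplicative.toAdd a).1.val * y ^ (Multiplicative.toAdd a).2.val
  map_one' := by simp
  map_mul' a b := by
    rw [toAdd_mul, Prod.fst_add, Prod.snd_add, ZMod.val_add, ZMod.val_add, ← pow_eq_pow_mod _ hx,
      ← pow_eq_pow_mod _ hy, pow_add, pow_add]
    simp only [mul_assoc]
    congr 1
    rw [← mul_assoc, ← mul_assoc]
    congr 1
    exact h.pow_pow _ _

namespace Satisfies

variable {G : Type v} [Group G] (hG : Satisfies G sevenFormulas)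
  {p : ℕ} [Fact p.Prime] (hp : p = 3 ∨ p = 5)
include hG

include hp in
theorem mem_sylow_of_smul_eq (P Q : Sylow p G) {x : G} (hx : x ∈ P) (h : x • Q = Q) : x ∈ Q := by
  by_cases h1 : x = 1
  · rw [h1]; exact one_mem Q
  refine IsPGroup.mem_sylow_of_mem_normalizer Q (k := 1) ?_ (Sylow.smul_eq_iff_mem_normalizer.1 h)
  have := pow_orderOf_eq_one x
  rw [hG.orderOf_of_mem_sylow hp P hx h1] at this
  rwa [pow_one]

include hp in
theorem toPermHom_sylow_injective (hd : p ∣ Nat.card G) (h1 : Nat.card (Sylow p G) ≠ 1) :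
    Function.Injective (MulAction.toPermHom G (Sylow p G)) := by
  have := hG.finite
  rw [injective_iff_map_eq_one]
  intro k hk
  have hfix : ∀ P : Sylow p G, k • P = P := fun P => DFunLike.congr_fun hk P
  let P : Sylow p G := default
  have hP : Nat.card P ≠ 1 := fun h => by
    have := P.dvd_card_of_dvd_card hd
    change p ∣ Nat.card P at this
    rw [h] at this
    exact (Fact.out : p.Prime).one_lt.ne' (Nat.dvd_one.1 this)
  obtain ⟨Q, hQ⟩ : ∃ Q : Sylow p G, P ≠ Q := by
    by_contra! h
    exact h1 (Nat.card_eq_one_iff_unique.2 ⟨⟨fun a b => (h a).symm.trans (h b)⟩, ⟨P⟩⟩)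
  obtain ⟨e, he, he1⟩ := P.exists_mem_ne_one hP
  have hcap : ∀ x ∈ P, (∀ R : Sylow p G, x • R = R) → x = 1 := fun x hx hR => by
    by_contra hne
    exact hQ (hG.sylow_eq_of_mem hp P Q hx (hG.mem_sylow_of_smul_eq hp P Q hx (hR Q)) hne)
  have hkN : k ∈ Subgroup.normalizer (P : Set G) := Sylow.smul_eq_iff_mem_normalizer.1 (hfix P)
  have hke : k * e * k⁻¹ * e⁻¹ = 1 := by
    refine hcap _ (mul_mem ((Subgroup.mem_normalizer_iff.1 hkN e).1 he) (inv_mem he)) fun R => ?_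
    have h2 : k⁻¹ • e⁻¹ • R = e⁻¹ • R := by rw [inv_smul_eq_iff, hfix]
    rw [mul_smul, mul_smul, mul_smul, h2, smul_inv_smul, hfix]
  refine hcap k (hG.mem_sylow_of_commute hp P he he1 ?_) hfix
  exact (mul_inv_eq_iff_eq_mul.1 (mul_inv_eq_one.1 hke)).symm

theorem exists_orderOf_eq (q : ℕ) [Fact q.Prime] (h : q ∣ Nat.card G) :
    ∃ x : G, orderOf x = q := by
  have := hG.finite
  exact exists_prime_orderOf_dvd_card' q h

theorem not_commute_of_orderOf {t x : G} (ht : orderOf t = 2) (hx : orderOf x = 3 ∨ orderOf x = 5) :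
    ¬ Commute t x := fun h => by
  have h1 := h.symm
  rcases hx with hx | hx
  · have := orderOf_dvd_of_pow_eq_one (hG.pow_eq_one_of_commute (Or.inl rfl) hx h1)
    rw [ht] at this; omega
  · have := orderOf_dvd_of_pow_eq_one (hG.pow_eq_one_of_commute (Or.inr rfl) hx h1)
    rw [ht] at this; omega

theorem isSection_of_card_le_four (h : Nat.card G ≤ 4) : IsSection G A₆ := by
  have := hG.finite
  exact isSection_of_perm h (MulAction.toPermHom G G) MulAction.toPerm_injective

theorem isSection_of_card_six (h : Nat.card G = 6) : IsSection G A₆ := by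
  have := hG.finite
  obtain ⟨t, ht⟩ := hG.exists_orderOf_eq 2 (by rw [h]; norm_num)
  obtain ⟨x, hx⟩ := hG.exists_orderOf_eq 3 (by rw [h]; norm_num)
  exact isSection_of_noncentral_involution ht (hG.not_commute_of_orderOf ht (Or.inl hx)) (by omega)

theorem isSection_of_card_eight (h : Nat.card G = 8) : IsSection G A₆ := by
  have := hG.finite
  have h' : Nat.card G = 2 ^ 3 := h
  obtain ⟨x, hx⟩ := hG.exists_orderOf_eq_four h' le_rfl
  obtain ⟨y, hy⟩ : ∃ y : G, y ∉ Subgroup.zpowers x := by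
    by_contra! h1
    have hz : Nat.card (Subgroup.zpowers x) = 4 := by rw [Nat.card_zpowers, hx]
    rw [(Subgroup.eq_top_iff' _).2 h1, Subgroup.card_top, h] at hz
    omega
  obtain ⟨h2, h3⟩ := hG.inverts_of_notMem_zpowers h' hx hy
  refine isSection_of_noncentral_involution h2 (g := x) (fun hc => ?_) h.le
  rw [hc.eq, mul_left_inj] at h3
  have h8 : x ^ 2 = 1 := by
    rw [pow_two]; nth_rw 1 [h3]; exact inv_mul_cancel x
  have := Nat.le_of_dvd (by norm_num) (orderOf_dvd_of_pow_eq_one h8)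
  omega

theorem isSection_of_card_sylow_three (h : 3 ∣ Nat.card G) (h4 : Nat.card (Sylow 3 G) = 4) :
    IsSection G A₆ := by
  have := hG.finite
  exact isSection_of_perm h4.le _ (hG.toPermHom_sylow_injective (Or.inl rfl) h (by omega))

theorem isSection_of_card_five (h : Nat.card G = 5) : IsSection G A₆ := by
  have := hG.finite
  have : Fintype G := Fintype.ofFinite G
  classical
  refine isSection_of_even (X := G) (by rw [← Nat.card_eq_fintype_card]; omega)
    (MulAction.toPermHom G G) MulAction.toPerm_injective fun g => ?_
  rw [← pow_one (Equiv.Perm.sign _), ← Int.units_pow_eq_pow_mod_two _ 5, ← map_pow, ← map_pow,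
    ← h, pow_card_eq_one', map_one, map_one]

theorem isSection_of_card_sixty (h : Nat.card G = 60) : IsSection G A₆ := by
  have := hG.finite
  have : Fintype (Sylow 5 G) := Fintype.ofFinite _
  classical
  have h5 : Nat.card (Sylow 5 G) = 6 := by
    have h1 := (hG.card_sylow_of_five_dvd (by omega)).1
    have h2 := hG.card_sylow_five_mod
    omega
  let φ := MulAction.toPermHom G (Sylow 5 G)
  refine isSection_of_even (by rw [← Nat.card_eq_fintype_card]; omega) φ
    (hG.toPermHom_sylow_injective (Or.inr rfl) (by omega) (by omega)) fun g => ?_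
  let s : G →* ℤˣ := Equiv.Perm.sign.comp φ
  have h1 := s.ker.card_mul_index
  rw [Subgroup.index_ker, h] at h1
  have h2 : Nat.card s.range ≤ 2 := by
    have := Subgroup.card_le_card_group s.range
    simpa using this
  have h3 := (hG.subgroup s.ker).card_of_five_dvd
  have h4 : Nat.card s.ker = 60 := by
    have : 0 < Nat.card s.range := Nat.card_pos
    interval_cases Nat.card s.range <;> omega
  have h6 : s.ker = ⊤ := Subgroup.eq_top_of_card_eq _ (by rw [h4, h])
  have h7 : g ∈ s.ker := h6 ▸ Subgroup.mem_top g
  exact h7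

theorem inverts_of_card_ten (h : Nat.card G = 10) {t x : G} (ht : orderOf t = 2)
    (hx : orderOf x = 5) : t * x * t⁻¹ = x⁻¹ := by
  have := hG.finite
  have hc : Nat.card (Subgroup.zpowers x) = 5 ^ (Nat.card G).factorization 5 := by
    rw [Nat.card_zpowers, hx, h, show (10 : ℕ) = 5 ^ 1 * 2 by norm_num,
      Nat.factorization_mul (by norm_num) (by norm_num),
      Nat.Prime.factorization_pow (by norm_num)]
    simp [Nat.factorization_eq_zero_of_not_dvd]
  let P : Sylow 5 G := Sylow.ofCard (Subgroup.zpowers x) hc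
  have hxP : x ∈ P := Subgroup.mem_zpowers x
  have hn : (Subgroup.zpowers x).Normal := Subgroup.normal_of_index_eq_two (by
    have := (Subgroup.zpowers x).card_mul_index
    rw [Nat.card_zpowers, hx, h] at this
    omega)
  have htN : t ∈ Subgroup.normalizer (P : Set G) := by
    have : Subgroup.normalizer ((Subgroup.zpowers x : Subgroup G) : Set G) = ⊤ :=
      Subgroup.normalizer_eq_top _
    exact this ▸ Subgroup.mem_top t
  exact hG.involution_conj_eq_inv (Or.inr rfl) P ht htN hxP

theorem isSection_of_card_ten (h : Nat.card G = 10) : IsSection G A₆ := by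
  have := hG.finite
  obtain ⟨t, ht⟩ := hG.exists_orderOf_eq 2 (by rw [h]; norm_num)
  obtain ⟨x, hx⟩ := hG.exists_orderOf_eq 5 (by rw [h]; norm_num)
  have x5 : x ^ 5 = 1 := hx ▸ pow_orderOf_eq_one x
  have t2 : t ^ 2 = 1 := ht ▸ pow_orderOf_eq_one t
  have hinv := hG.inverts_of_card_ten h ht hx
  let x' : A₆ := ⟨c[0, 1, 2, 3, 4], by rw [Equiv.Perm.mem_alternatingGroup]; decide⟩
  let t' : A₆ := ⟨c[1, 4] * c[2, 3], by rw [Equiv.Perm.mem_alternatingGroup]; decide⟩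
  have hz : ∀ v : ZMod 5, x ^ v.val = 1 → v = 0 := fun v hv => by
    have h1 := orderOf_dvd_of_pow_eq_one hv
    rw [hx] at h1
    rw [← ZMod.natCast_zmod_val v, ZMod.natCast_eq_zero_iff]
    exact h1
  obtain ⟨φ, hφ⟩ := exists_injective_of_semidirect (V := ZMod 5) (zmodPowHom 5 x x5)
    (zmodPowHom 5 x' (by decide +kernel)) t t' 2 (by norm_num) t2 (by decide +kernel) (fun v => -v)
    (fun v => by
      rw [ofAdd_neg, map_inv, ← mul_inv_eq_iff_eq_mul]
      show t * x ^ v.val * t⁻¹ = (x ^ v.val)⁻¹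
      rw [← conj_pow, hinv, inv_pow])
    (by decide +kernel)
    (fun v c hc => by
      show x ^ v.val * t ^ c = 1 → _
      intro h1
      interval_cases c
      · rw [pow_zero, mul_one] at h1
        exact ⟨hz v h1, rfl⟩
      · exfalso
        rw [pow_one] at h1
        have h2 : t = (x ^ v.val)⁻¹ := (inv_eq_of_mul_eq_one_right h1).symm
        exact hG.not_commute_of_orderOf ht (Or.inr hx)
          (h2 ▸ ((Commute.refl x).pow_left _).inv_left))
    (by decide +kernel) (by rw [h, Nat.card_zmod])
  exact isSection_of_injective φ hφ

end Satisfies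

theorem prod_pow_eq_one_iff {G : Type v} [Group G] {x y : G} (hx : orderOf x = 3)
    (hy : y ^ 3 = 1) (h : y ∉ Subgroup.zpowers x) (v : ZMod 3 × ZMod 3)
    (hv : x ^ v.1.val * y ^ v.2.val = 1) : v = 0 := by
  obtain ⟨a, b⟩ := v
  have h1 : y ^ b.val ∈ Subgroup.zpowers x := by
    have hv : x ^ a.val * y ^ b.val = 1 := hv
    rw [← inv_eq_of_mul_eq_one_right hv]
    exact inv_mem (pow_mem (Subgroup.mem_zpowers x) _)
  obtain rfl : b = 0 := by
    fin_cases b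
    · rfl
    · exact absurd ((pow_one y).symm ▸ h1) h
    · refine absurd ?_ h
      have h2 : y = (y ^ 2) ^ 2 := by
        rw [← pow_mul, show 2 * 2 = 3 + 1 by norm_num, pow_succ, hy, one_mul]
      rw [h2]; exact pow_mem h1 _
  have h2 : x ^ a.val = 1 := by simpa using hv
  have h3 := orderOf_dvd_of_pow_eq_one h2
  rw [hx] at h3
  have h4 : a = 0 := by rw [← ZMod.natCast_zmod_val a, ZMod.natCast_eq_zero_iff]; exact h3
  rw [h4]; rfl

namespace Satisfies

variable {G : Type v} [Group G] (hG : Satisfies G sevenFormulas)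
include hG

theorem exists_orderOf_four_mem_normalizer (P : Sylow 3 G) (hP : Nat.card P = 9)
    (hN : Nat.card (Subgroup.normalizer (P : Set G)) = 36) :
    ∃ h ∈ Subgroup.normalizer (P : Set G), orderOf h = 4 := by
  have := hG.finite
  by_contra! hno
  obtain ⟨S, hS⟩ := Sylow.exists_subgroup_card_pow_prime
    (G := Subgroup.normalizer (P : Set G)) 2 (n := 2) (by rw [hN]; norm_num)
  have hGS := (hG.subgroup (Subgroup.normalizer (P : Set G))).subgroup S
  obtain ⟨e, he, he1⟩ := P.exists_mem_ne_one (by omega)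
  have h2 : ∀ a : S, a ≠ 1 → orderOf a = 2 := fun a ha => by
    rcases hGS.orderOf_of_card_eq_two_pow hS a with h1 | h1 | h1
    · exact absurd (orderOf_eq_one_iff.1 h1) ha
    · exact h1
    · exact absurd (by rw [Subgroup.orderOf_coe, Subgroup.orderOf_coe, h1]) (hno a a.1.2)
  have hsq : ∀ a : S, a * a = 1 := fun a => by
    by_cases ha : a = 1
    · simp [ha]
    · rw [← pow_two, ← h2 a ha, pow_orderOf_eq_one]
  have hcomm : ∀ a b : S, a * b = b * a := fun a b => by
    have h1 : ∀ a : S, a⁻¹ = a := fun a => inv_eq_of_mul_eq_one_right (hsq a)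
    have := h1 (a * b)
    rw [mul_inv_rev, h1, h1] at this
    exact this.symm
  have huniq : ∀ a b : S, a ≠ 1 → b ≠ 1 → a = b := fun a b ha hb => by
    refine Subtype.ext (Subtype.ext (hG.involution_unique (Or.inl rfl) P he he1
      ?_ ?_ a.1.2 b.1.2 ?_))
    · rw [Subgroup.orderOf_coe, Subgroup.orderOf_coe, h2 a ha]
    · rw [Subgroup.orderOf_coe, Subgroup.orderOf_coe, h2 b hb]
    · exact congrArg (fun z : S => ((z : Subgroup.normalizer (P : Set G)) : G)) (hcomm a b)
  have hle : Nat.card S ≤ Nat.card Bool := by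
    classical
    refine Nat.card_le_card_of_injective (fun a : S => decide (a = 1)) fun a b hab => ?_
    simp only [decide_eq_decide] at hab
    by_cases ha : a = 1
    · rw [ha, hab.1 ha]
    · exact huniq a b ha (fun hb => ha (hab.2 hb))
  rw [hS] at hle
  simp at hle

theorem conj_conj_eq_inv (P : Sylow 3 G) {h x : G} (hN : h ∈ Subgroup.normalizer (P : Set G))
    (h4 : orderOf h = 4) (hx : x ∈ P) : h * (h * x * h⁻¹) * h⁻¹ = x⁻¹ := by
  have := hG.finite
  have h2 : orderOf (h ^ 2) = 2 := by rw [orderOf_pow, h4]; rfl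
  rw [← hG.involution_conj_eq_inv (Or.inl rfl) P h2 (pow_mem hN 2) hx, pow_two]
  group

theorem conj_notMem_zpowers (P : Sylow 3 G) {h x : G} (hN : h ∈ Subgroup.normalizer (P : Set G))
    (h4 : orderOf h = 4) (hx : x ∈ P) (hx1 : x ≠ 1) : h * x * h⁻¹ ∉ Subgroup.zpowers x := by
  classical
  have := hG.finite
  intro hm
  have h3 := hG.orderOf_of_mem_sylow (Or.inl rfl) P hx hx1
  have x3 : x ^ 3 = 1 := h3 ▸ pow_orderOf_eq_one x
  have hinv := hG.conj_conj_eq_inv P hN h4 hx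
  have hne : x ≠ x⁻¹ := fun h' => by
    have h5 : x ^ 2 = 1 := by rw [pow_two]; nth_rw 1 [h']; exact inv_mul_cancel x
    have h6 := orderOf_dvd_of_pow_eq_one h5
    rw [h3] at h6
    omega
  obtain ⟨k, hk, hkx⟩ := Finset.mem_image.1 (mem_zpowers_iff_mem_range_orderOf.1 hm)
  rw [Finset.mem_range, h3] at hk
  have hkx : h * x * h⁻¹ = x ^ k := hkx.symm
  rw [hkx, ← conj_pow, hkx, ← pow_mul] at hinv
  interval_cases k
  · exact hx1 (by simpa using hkx)
  · exact hne (by simpa using hinv)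
  · refine hne ?_
    rwa [show 2 * 2 = 3 + 1 by norm_num, pow_succ, x3, one_mul] at hinv

theorem exists_basis (P : Sylow 3 G) (hP : Nat.card P = 9) :
    ∃ x y, x ∈ P ∧ y ∈ P ∧ orderOf x = 3 ∧ orderOf y = 3 ∧ y ∉ Subgroup.zpowers x := by
  have := hG.finite
  obtain ⟨x, hx, hx1⟩ := P.exists_mem_ne_one (by omega)
  have h3 := hG.orderOf_of_mem_sylow (Or.inl rfl) P hx hx1
  obtain ⟨y, hy, hyx⟩ : ∃ y ∈ P, y ∉ Subgroup.zpowers x := by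
    by_contra! h
    have h1 : (P : Subgroup G) ≤ Subgroup.zpowers x := h
    have h2 := Subgroup.card_le_of_le h1
    rw [Nat.card_zpowers, h3] at h2
    change Nat.card P ≤ 3 at h2
    omega
  refine ⟨x, y, hx, hy, h3, hG.orderOf_of_mem_sylow (Or.inl rfl) P hy fun h => ?_, hyx⟩
  exact hyx (h ▸ one_mem _)

theorem isSection_of_sylow_basis (P : Sylow 3 G) {x y h : G} {k : ℕ} (m : ZMod 3 × ZMod 3 → ZMod 3 × ZMod 3)
    (h' : A₆) (hx : x ∈ P) (hy : y ∈ P) (hx3 : orderOf x = 3) (hy3 : orderOf y = 3)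
    (hxy : y ∉ Subgroup.zpowers x) (hk : 0 < k) (h3k : ¬ 3 ∣ k) (hh : orderOf h = k) (hh' : h' ^ k = 1)
    (hm : ∀ v : ZMod 3 × ZMod 3,
      h * (x ^ v.1.val * y ^ v.2.val) = x ^ (m v).1.val * y ^ (m v).2.val * h)
    (x' y' : A₆) (hx3' : x' ^ 3 = 1) (hy3' : y' ^ 3 = 1) (hxy' : Commute x' y')
    (hm' : ∀ v : ZMod 3 × ZMod 3,
      h' * (x' ^ v.1.val * y' ^ v.2.val) = x' ^ (m v).1.val * y' ^ (m v).2.val * h')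
    (hi' : ∀ v : ZMod 3 × ZMod 3, ∀ c < k,
      x' ^ v.1.val * y' ^ v.2.val * h' ^ c = 1 → v = 0 ∧ c = 0)
    (hc : Nat.card G = 9 * k) : IsSection G A₆ := by
  have := hG.finite
  have x3 : x ^ 3 = 1 := hx3 ▸ pow_orderOf_eq_one x
  have y3 : y ^ 3 = 1 := hy3 ▸ pow_orderOf_eq_one y
  have hcomm := hG.commute_of_mem_sylow (Or.inl rfl) P hx hy
  obtain ⟨φ, hφ⟩ := exists_injective_of_semidirect (V := ZMod 3 × ZMod 3)
    (zmodPowHom₂ 3 x y x3 y3 hcomm) (zmodPowHom₂ 3 x' y' hx3' hy3' hxy') h h' k hk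
    (hh ▸ pow_orderOf_eq_one h) hh' m hm hm'
    (fun v c hc => by
      show x ^ v.1.val * y ^ v.2.val * h ^ c = 1 → _
      intro h1
      have h2 : h ^ c ∈ P := by
        rw [← inv_eq_of_mul_eq_one_right h1]
        exact inv_mem (mul_mem (pow_mem hx _) (pow_mem hy _))
      have h3 : (h ^ c) ^ 3 = 1 := by
        by_cases h0 : h ^ c = 1
        · rw [h0, one_pow]
        · rw [← hG.orderOf_of_mem_sylow (Or.inl rfl) P h2 h0, pow_orderOf_eq_one]
      rw [← pow_mul] at h3
      have h4 := orderOf_dvd_of_pow_eq_one h3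
      rw [hh] at h4
      have h5 : k ∣ c := Nat.Coprime.dvd_of_dvd_mul_right
        (((Nat.Prime.coprime_iff_not_dvd Nat.prime_three).2 h3k).symm) h4
      obtain rfl : c = 0 := Nat.eq_zero_of_dvd_of_lt h5 hc
      rw [pow_zero, mul_one] at h1
      exact ⟨prod_pow_eq_one_iff hx3 y3 hxy v h1, rfl⟩)
    hi' (by rw [hc, Nat.card_prod, Nat.card_zmod])
  exact isSection_of_injective φ hφ

end Satisfies

theorem cycle_zero_one_two_mem : (c[0, 1, 2] : Equiv.Perm (Fin 6)) ∈ A₆ := by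
  rw [Equiv.Perm.mem_alternatingGroup]; decide

theorem cycle_three_four_five_mem : (c[3, 4, 5] : Equiv.Perm (Fin 6)) ∈ A₆ := by
  rw [Equiv.Perm.mem_alternatingGroup]; decide

theorem swap_mul_four_cycle_mem : (c[0, 3] * c[1, 4, 2, 5] : Equiv.Perm (Fin 6)) ∈ A₆ := by
  rw [Equiv.Perm.mem_alternatingGroup]; decide

namespace Satisfies

variable {G : Type v} [Group G] (hG : Satisfies G sevenFormulas)
include hG

theorem isSection_of_card_nine (h : Nat.card G = 9) : IsSection G A₆ := by
  let P : Sylow 3 G := default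
  obtain ⟨x, y, hx, hy, hx3, hy3, hxy⟩ := hG.exists_basis P (hG.card_sylow_eq_nine (by rw [h]) P)
  exact hG.isSection_of_sylow_basis P (h := 1) (k := 1) id 1 hx hy hx3 hy3 hxy (by norm_num)
    (by norm_num) orderOf_one (by simp) (by simp) ⟨_, cycle_zero_one_two_mem⟩
    ⟨_, cycle_three_four_five_mem⟩ (by decide +kernel) (by decide +kernel)
    (by unfold Commute SemiconjBy; decide +kernel) (by decide +kernel) (by decide +kernel) h

omit hG in
theorem _root_.Sylow.mem_normalizer_of_card_eq_one (P : Sylow 3 G) (h : Nat.card (Sylow 3 G) = 1) (g : G) :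
    g ∈ Subgroup.normalizer (P : Set G) :=
  Sylow.smul_eq_iff_mem_normalizer.1 ((Nat.card_eq_one_iff_unique.1 h).1.elim _ _)

theorem isSection_of_card_eighteen (h : Nat.card G = 18) (h1 : Nat.card (Sylow 3 G) = 1) :
    IsSection G A₆ := by
  let P : Sylow 3 G := default
  obtain ⟨x, y, hx, hy, hx3, hy3, hxy⟩ :=
    hG.exists_basis P (hG.card_sylow_eq_nine (by rw [h]; norm_num) P)
  obtain ⟨t, ht⟩ := hG.exists_orderOf_eq 2 (by rw [h]; norm_num)
  have htN := P.mem_normalizer_of_card_eq_one h1 t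
  have hcomm := hG.commute_of_mem_sylow (Or.inl rfl) P hx hy
  have x3 : x ^ 3 = 1 := hx3 ▸ pow_orderOf_eq_one x
  have y3 : y ^ 3 = 1 := hy3 ▸ pow_orderOf_eq_one y
  refine hG.isSection_of_sylow_basis P (h := t) (k := 2) (fun v => -v)
    (⟨_, swap_mul_four_cycle_mem⟩ ^ 2) hx hy hx3 hy3 hxy (by norm_num)
    (by norm_num) ht (by decide +kernel) (fun v => ?_) ⟨_, cycle_zero_one_two_mem⟩
    ⟨_, cycle_three_four_five_mem⟩ (by decide +kernel) (by decide +kernel)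
    (by unfold Commute SemiconjBy; decide +kernel) (by decide +kernel) (by decide +kernel) h
  have h2 : zmodPowHom₂ 3 x y x3 y3 hcomm (.ofAdd (-v)) =
    (zmodPowHom₂ 3 x y x3 y3 hcomm (.ofAdd v))⁻¹ := by rw [ofAdd_neg, map_inv]
  have h3 : x ^ (-v).1.val * y ^ (-v).2.val = (x ^ v.1.val * y ^ v.2.val)⁻¹ := h2
  rw [h3, ← hG.involution_conj_eq_inv (Or.inl rfl) P ht htN
    (mul_mem (pow_mem hx _) (pow_mem hy _))]
  group

omit hG in
theorem _root_.mul_pow_mul_pow_eq {x y h : G} (hxy : Commute x y) (hx : x ^ 3 = 1)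
    (h1 : h * x * h⁻¹ = y) (h2 : h * y * h⁻¹ = x⁻¹) (v : ZMod 3 × ZMod 3) :
    h * (x ^ v.1.val * y ^ v.2.val) = x ^ (-v.2).val * y ^ v.1.val * h := by
  have h3 : x ^ (-v.2).val = (x ^ v.2.val)⁻¹ := by
    have : zmodPowHom 3 x hx (.ofAdd (-v.2)) = (zmodPowHom 3 x hx (.ofAdd v.2))⁻¹ := by
      rw [ofAdd_neg, map_inv]
    exact this
  rw [← mul_inv_eq_iff_eq_mul, h3]
  have h4 : h * y ^ v.2.val * h⁻¹ = (x ^ v.2.val)⁻¹ := by rw [← conj_pow, h2, inv_pow]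
  have h5 : h * x ^ v.1.val * h⁻¹ = y ^ v.1.val := by rw [← conj_pow, h1]
  have h6 : (x ^ v.2.val)⁻¹ * y ^ v.1.val = y ^ v.1.val * (x ^ v.2.val)⁻¹ :=
    ((hxy.pow_pow _ _).inv_left).eq
  calc h * (x ^ v.1.val * y ^ v.2.val) * h⁻¹
      = (h * x ^ v.1.val * h⁻¹) * (h * y ^ v.2.val * h⁻¹) := by group
    _ = _ := by rw [h4, h5, h6]

theorem isSection_of_card_thirtySix (h : Nat.card G = 36) (h1 : Nat.card (Sylow 3 G) = 1) :
    IsSection G A₆ := by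
  have := hG.finite
  let P : Sylow 3 G := default
  have hP := hG.card_sylow_eq_nine (by rw [h]; norm_num) P
  have hN : Nat.card (Subgroup.normalizer (P : Set G)) = 36 := by
    have := P.card_mul_card_normalizer
    rw [h1, h] at this
    omega
  obtain ⟨t, htN, ht⟩ := hG.exists_orderOf_four_mem_normalizer P hP hN
  obtain ⟨x, hx, hx1⟩ := P.exists_mem_ne_one (by omega)
  have hx3 := hG.orderOf_of_mem_sylow (Or.inl rfl) P hx hx1
  have x3 : x ^ 3 = 1 := hx3 ▸ pow_orderOf_eq_one x
  have hy : t * x * t⁻¹ ∈ P := (Subgroup.mem_normalizer_iff.1 htN x).1 hx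
  have hxy := hG.conj_notMem_zpowers P htN ht hx hx1
  have hy3 := hG.orderOf_of_mem_sylow (Or.inl rfl) P hy (fun h => hxy (h ▸ one_mem _))
  have hcomm := hG.commute_of_mem_sylow (Or.inl rfl) P hx hy
  exact hG.isSection_of_sylow_basis P (h := t) (k := 4) (fun v => (-v.2, v.1))
    ⟨_, swap_mul_four_cycle_mem⟩ hx hy hx3 hy3 hxy (by norm_num)
    (by norm_num) ht (by decide +kernel)
    (mul_pow_mul_pow_eq hcomm x3 rfl (hG.conj_conj_eq_inv P htN ht hx))
    ⟨_, cycle_zero_one_two_mem⟩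
    ⟨_, cycle_three_four_five_mem⟩ (by decide +kernel) (by decide +kernel)
    (by unfold Commute SemiconjBy; decide +kernel) (by decide +kernel) (by decide +kernel) h

theorem isSection_of_card_ne (h : Nat.card G ≠ 360) : IsSection G A₆ := by
  by_cases h5 : 5 ∣ Nat.card G
  · rcases hG.card_of_five_dvd h5 with h1 | h1 | h1 | h1
    · exact hG.isSection_of_card_five h1
    · exact hG.isSection_of_card_ten h1
    · exact hG.isSection_of_card_sixty h1
    · exact absurd h1.1 h
  · rcases hG.card_of_not_five_dvd h5 with h1 | h1 | h1 | h1 | h1 | ⟨h1 | h1 | h1, h2⟩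
    · exact hG.isSection_of_card_le_four h1
    · exact hG.isSection_of_card_six h1
    · exact hG.isSection_of_card_eight h1
    · exact hG.isSection_of_card_sylow_three (by rw [h1.1]; norm_num) h1.2
    · exact hG.isSection_of_card_sylow_three (by rw [h1.1]; norm_num) h1.2
    · exact hG.isSection_of_card_nine h1
    · exact hG.isSection_of_card_eighteen h1 h2
    · exact hG.isSection_of_card_thirtySix h1 h2

end Satisfies

/-- The projective line over the field of nine elements, as a set of ten points. -/
abbrev TenPoints : Type := Option (ZMod 3 × ZMod 3)

namespace TenPoints

/-- The translation `z ↦ z + 1`. -/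
def transl : Equiv.Perm TenPoints := Equiv.optionCongr ((Equiv.addRight 1).prodCongr (Equiv.refl _))

/-- The rotation `z ↦ iz`. -/
def rot : Equiv.Perm TenPoints where
  toFun := Option.map fun v => (-v.2, v.1)
  invFun := Option.map fun v => (v.2, -v.1)
  left_inv v := by cases v <;> simp
  right_inv v := by cases v <;> simp

/-- The map that commutes with inverse rotations, swaps `0` and `∞`, and sends `1` and `1 + i`
to given points. -/
def swapFun (a b : TenPoints) : TenPoints → TenPoints
  | none => some (0, 0)
  | some (0, 0) => none
  | some (1, 0) => a
  | some (0, 1) => rot.symm a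
  | some (2, 0) => rot.symm (rot.symm a)
  | some (0, 2) => rot a
  | some (1, 1) => b
  | some (2, 1) => rot.symm b
  | some (2, 2) => rot.symm (rot.symm b)
  | some (1, 2) => rot b

/-- The inversion `z ↦ z⁻¹`. -/
def inversion : Equiv.Perm TenPoints where
  toFun := swapFun (some (1, 0)) (some (2, 1))
  invFun := swapFun (some (1, 0)) (some (2, 1))
  left_inv := by unfold Function.LeftInverse; decide +kernel
  right_inv := by unfold Function.RightInverse Function.LeftInverse; decide +kernel

theorem exists_swapFun_eq_inversion : ∀ a b : TenPoints,
    (∀ v, swapFun a b (swapFun a b v) = v) →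
    (∀ (j : Fin 4) (i : Fin 2),
      (∀ v, (transl ∘ rot^[i.1] ∘ swapFun a b ∘ rot^[j.1])^[3] v = v) ∨
      (∀ v, (transl ∘ rot^[i.1] ∘ swapFun a b ∘ rot^[j.1])^[4] v = v) ∨
      (∀ v, (transl ∘ rot^[i.1] ∘ swapFun a b ∘ rot^[j.1])^[5] v = v)) →
    ∃ j : Fin 4, ∀ v, swapFun a b (rot^[j.1] v) = inversion v := by
  decide +kernel

theorem eq_swapFun (f : TenPoints → TenPoints) (h0 : f none = some (0, 0))
    (h1 : f (some (0, 0)) = none) (h : ∀ v, f (rot v) = rot.symm (f v)) :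
    f = swapFun (f (some (1, 0))) (f (some (1, 1))) := by
  have hr : ∀ v w, rot v = w → f w = rot.symm (f v) := fun v w hvw => hvw ▸ h v
  have e1 := hr (some (1, 0)) (some (0, 1)) (by decide)
  have e2 := hr (some (0, 1)) (some (2, 0)) (by decide)
  have e3 := hr (some (0, 2)) (some (1, 0)) (by decide)
  have e4 := hr (some (1, 1)) (some (2, 1)) (by decide)
  have e5 := hr (some (2, 1)) (some (2, 2)) (by decide)
  have e6 := hr (some (1, 2)) (some (1, 1)) (by decide)
  rw [Equiv.eq_symm_apply] at e3 e6
  rw [e1] at e2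
  rw [e4] at e5
  funext v
  rcases v with _ | ⟨a, b⟩
  · exact h0
  · fin_cases a <;> fin_cases b
    exacts [h1, e1, e3.symm, rfl, rfl, e6.symm, e2, e4, e5]

end TenPoints

namespace Satisfies

variable {G : Type v} [Group G] (hG : Satisfies G sevenFormulas)
include hG

theorem exists_smul_sylow_eq (h : Nat.card (Sylow 3 G) = 10) (h9 : 9 ∣ Nat.card G)
    {P Q R : Sylow 3 G} (hQ : P ≠ Q) (hR : P ≠ R) : ∃ x ∈ P, x • Q = R := by
  have := hG.finite
  have hP : Nat.card P = 9 := hG.card_sylow_eq_nine h9 P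
  have hinj : Function.Injective fun o : Option P => o.elim P fun x => (x : G) • Q := by
    rintro (_ | x) (_ | y) hxy
    · rfl
    · exact absurd hxy.symm (P.smul_ne_of_mem Q hQ y)
    · exact absurd hxy (P.smul_ne_of_mem Q hQ x)
    · exact congrArg some (hG.smul_sylow_injective (Or.inl rfl) P Q hQ hxy)
  have hbij := (Nat.bijective_iff_injective_and_card _).2 ⟨hinj, by
    rw [Finite.card_option, h]; exact congrArg (· + 1) hP⟩
  obtain ⟨_ | x, hx⟩ := hbij.2 R
  · exact absurd hx hR
  · exact ⟨x, x.2, hx⟩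

theorem exists_swap (h : Nat.card (Sylow 3 G) = 10) (h9 : 9 ∣ Nat.card G)
    {P Q : Sylow 3 G} (hQ : P ≠ Q) : ∃ w : G, w • P = Q ∧ w • Q = P := by
  have := hG.finite
  classical
  have : Fintype (Sylow 3 G) := Fintype.ofFinite _
  obtain ⟨R, hR⟩ : ∃ R, R ∉ ({P, Q} : Finset (Sylow 3 G)) := by
    by_contra! h1
    have h2 : ({P, Q} : Finset (Sylow 3 G)) = Finset.univ := Finset.eq_univ_iff_forall.2 h1
    have h3 := Finset.card_le_two (a := P) (b := Q)
    rw [h2, Finset.card_univ, ← Nat.card_eq_fintype_card, h] at h3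
    omega
  simp only [Finset.mem_insert, Finset.mem_singleton, not_or] at hR
  obtain ⟨u, -, hu⟩ := hG.exists_smul_sylow_eq h h9 hR.1 hR.2
  have hne : u • Q ≠ Q := fun h1 => hQ (by
    rw [← smul_left_cancel_iff u, hu, h1])
  obtain ⟨q, hq, hq1⟩ := hG.exists_smul_sylow_eq h h9 hne.symm hQ.symm
  refine ⟨q * u, ?_, ?_⟩
  · rw [mul_smul, hu, Sylow.smul_eq_iff_mem_normalizer]
    exact Subgroup.le_normalizer hq
  · rw [mul_smul, hq1]

theorem exists_fixed_sylow {P : Sylow 3 G} (h : Nat.card (Sylow 3 G) = 10) {t : G}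
    (ht : orderOf t = 4) (htP : t • P = P) : ∃ Q, P ≠ Q ∧ t • Q = Q := by
  have := hG.finite
  have hZ : IsPGroup 2 (Subgroup.zpowers t) :=
    IsPGroup.of_card (n := 2) (by rw [Nat.card_zpowers, ht]; norm_num)
  obtain ⟨Q, hQ, hne⟩ := hZ.exists_fixed_point_of_prime_dvd_card_of_fixed_point (Sylow 3 G)
    (by rw [h]; norm_num) (a := P) (by
      rintro ⟨_, k, rfl⟩
      exact MulAction.mem_stabilizer_iff.1
        (zpow_mem (MulAction.mem_stabilizer_iff.2 htP) k))
  exact ⟨Q, hne, hQ ⟨t, Subgroup.mem_zpowers t⟩⟩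

theorem sq_eq_one_of_swap {P Q : Sylow 3 G} (hQ : P ≠ Q) {t w : G} (ht : orderOf t = 4)
    (htP : t • P = P) (htQ : t • Q = Q) (hP : w • P = Q) (hwQ : w • Q = P) : w ^ 2 = 1 := by
  have hodd : ∀ g : G, g • P = Q → g • Q = P → g ^ 15 ≠ 1 := fun g h1 h2 h3 => by
    have h4 : g ^ 2 • P = P := by rw [pow_two, mul_smul, h1, h2]
    have h5 : (g ^ 2) ^ 7 • P = P := MulAction.mem_stabilizer_iff.1
      (pow_mem (MulAction.mem_stabilizer_iff.2 h4) 7)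
    have h6 : g * (g ^ 2) ^ 7 = 1 := by rw [← h3]; group
    have h7 : (g * (g ^ 2) ^ 7) • P = P := by rw [h6, one_smul]
    rw [mul_smul, h5, h1] at h7
    exact hQ h7.symm
  have hdvd : ¬ orderOf w ∣ 15 := fun h => hodd w hP hwQ (orderOf_dvd_iff_pow_eq_one.1 h)
  have h4 : orderOf w ≠ 4 := fun h4 => by
    have hk : ∀ k : ℕ, (w * t ^ k) ^ 15 ≠ 1 := fun k => by
      have e1 : t ^ k • P = P := MulAction.mem_stabilizer_iff.1
        (pow_mem (MulAction.mem_stabilizer_iff.2 htP) k)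
      have e2 : t ^ k • Q = Q := MulAction.mem_stabilizer_iff.1
        (pow_mem (MulAction.mem_stabilizer_iff.2 htQ) k)
      exact hodd _ (by rw [mul_smul, e1, hP]) (by rw [mul_smul, e2, hwQ])
    rcases hG.exists_even_of_orderOf_eq_four h4 ht with h | h | h
    · exact hk 1 (by rwa [pow_one])
    · exact hk 2 h
    · exact hk 3 h
  rw [← orderOf_dvd_iff_pow_eq_one]
  rcases hG.orderOf_cases w with h | h | h | h | h
  all_goals rw [h] at hdvd h4 ⊢
  all_goals omega

theorem closure_eq_top (hc : Nat.card G = 360) {P : Sylow 3 G}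
    (hN : Nat.card (Subgroup.normalizer (P : Set G)) = 36) {t w : G}
    (ht : orderOf t = 4) (htN : t ∈ Subgroup.normalizer (P : Set G))
    (hw : w ∉ Subgroup.normalizer (P : Set G)) (M : Subgroup G) (hPM : (P : Subgroup G) ≤ M)
    (htM : t ∈ M) (hwM : w ∈ M) : M = ⊤ := by
  have := hG.finite
  have hP : Nat.card (P : Subgroup G) = 9 := hG.card_sylow_eq_nine (by rw [hc]; norm_num) P
  have hdvd : ∀ K : Subgroup G, (P : Subgroup G) ≤ K → t ∈ K → 36 ∣ Nat.card K := fun K h1 h2 => by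
    have h3 := Subgroup.card_dvd_of_le h1
    have h4 := Subgroup.card_dvd_of_le (Subgroup.zpowers_le.2 h2)
    rw [Nat.card_zpowers, ht] at h4
    rw [hP] at h3
    omega
  have h1 : Nat.card (Subgroup.normalizer (P : Set G) ⊓ M : Subgroup G) = 36 := by
    have h2 := hdvd _ (le_inf Subgroup.le_normalizer hPM) ⟨htN, htM⟩
    have h3 := Subgroup.card_dvd_of_le (inf_le_left : Subgroup.normalizer (P : Set G) ⊓ M ≤ _)
    rw [hN] at h3
    exact Nat.dvd_antisymm h3 h2
  have h2 : Subgroup.normalizer (P : Set G) ≤ M := by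
    have := Subgroup.eq_of_le_of_card_ge
      (inf_le_left : Subgroup.normalizer (P : Set G) ⊓ M ≤ _) (by rw [h1, hN])
    exact inf_eq_left.1 this
  have h3 := hdvd M hPM htM
  have h4 : Nat.card M ≠ 36 := fun h4 => by
    have := Subgroup.eq_of_le_of_card_ge h2 (by rw [h4, hN])
    exact hw (this ▸ hwM)
  have h5 : Nat.card M = 360 := by
    by_cases h5 : 5 ∣ Nat.card M
    · have := (hG.subgroup M).card_of_five_dvd h5
      omega
    · have := (hG.subgroup M).card_of_not_five_dvd h5
      have : 0 < Nat.card M := Nat.card_pos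
      omega
  exact Subgroup.eq_top_of_card_eq _ (by rw [h5, hc])

theorem exists_injective_range_eq (hc : Nat.card G = 360) :
    ∃ ψ : G →* Equiv.Perm TenPoints, Function.Injective ψ ∧ ψ.range =
      Subgroup.closure {TenPoints.transl, TenPoints.rot, TenPoints.inversion} := by
  have := hG.finite
  have h9 : 9 ∣ Nat.card G := by rw [hc]; norm_num
  have h10 : Nat.card (Sylow 3 G) = 10 := by
    rcases hG.card_of_five_dvd (by rw [hc]; norm_num) with h | h | h | h
    · omega
    · omega
    · omega
    · exact h.2
  let P : Sylow 3 G := default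
  have hP := hG.card_sylow_eq_nine h9 P
  have hN : Nat.card (Subgroup.normalizer (P : Set G)) = 36 := by
    have := P.card_mul_card_normalizer
    rw [h10, hc] at this
    omega
  obtain ⟨t, htN, ht⟩ := hG.exists_orderOf_four_mem_normalizer P hP hN
  have htP : t • P = P := Sylow.smul_eq_iff_mem_normalizer.2 htN
  obtain ⟨Q, hQ, htQ⟩ := hG.exists_fixed_sylow h10 ht htP
  obtain ⟨x, hx, hx1⟩ := P.exists_mem_ne_one (by omega)
  obtain ⟨w, hwP, hwQ⟩ := hG.exists_swap h10 h9 hQ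
  have hx3 := hG.orderOf_of_mem_sylow (Or.inl rfl) P hx hx1
  have x3 : x ^ 3 = 1 := hx3 ▸ pow_orderOf_eq_one x
  set y := t * x * t⁻¹ with hydef
  have hy : y ∈ P := (Subgroup.mem_normalizer_iff.1 htN x).1 hx
  have hxy := hG.conj_notMem_zpowers P htN ht hx hx1
  have hy3 := hG.orderOf_of_mem_sylow (Or.inl rfl) P hy
    (fun h => hxy (by rw [← hydef, h]; exact one_mem _))
  have y3 : y ^ 3 = 1 := hy3 ▸ pow_orderOf_eq_one y
  have hcomm := hG.commute_of_mem_sylow (Or.inl rfl) P hx hy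
  let e := zmodPowHom₂ 3 x y x3 y3 hcomm
  have he : ∀ v, e v ∈ P := fun v => mul_mem (pow_mem hx _) (pow_mem hy _)
  have heinj : Function.Injective e := by
    rw [injective_iff_map_eq_one]
    exact fun v hv => prod_pow_eq_one_iff hx3 y3 hxy v hv
  -- the labelling of the Sylow subgroups by the ten points
  let f : TenPoints → Sylow 3 G := fun o => o.elim P fun v => e (.ofAdd v) • Q
  have hfinj : Function.Injective f := by
    rintro (_ | v) (_ | u) hvu
    · rfl
    · exact absurd hvu.symm (P.smul_ne_of_mem Q hQ ⟨_, he _⟩)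
    · exact absurd hvu (P.smul_ne_of_mem Q hQ ⟨_, he _⟩)
    · have := hG.smul_sylow_injective (Or.inl rfl) P Q hQ
        (a₁ := ⟨_, he (.ofAdd v)⟩) (a₂ := ⟨_, he (.ofAdd u)⟩) hvu
      exact congrArg some (heinj (congrArg Subtype.val this))
  have hfbij : Function.Bijective f := (Nat.bijective_iff_injective_and_card f).2
    ⟨hfinj, by rw [h10]; simp [TenPoints, Nat.card_eq_fintype_card, ZMod.card]⟩
  let ε : TenPoints ≃ Sylow 3 G := Equiv.ofBijective f hfbij
  let ψ : G →* Equiv.Perm TenPoints :=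
    (Equiv.permCongrHom ε.symm).toMonoidHom.comp (MulAction.toPermHom G (Sylow 3 G))
  have hψinj : Function.Injective ψ := (Equiv.permCongrHom ε.symm).injective.comp
    (hG.toPermHom_sylow_injective (Or.inl rfl) (by rw [hc]; norm_num) (by omega))
  have hψ : ∀ g v, f (ψ g v) = g • f v := fun g v => ε.apply_symm_apply _
  have hψ' : ∀ g v u, g • f v = f u → ψ g v = u := fun g v u h => hfinj (by rw [hψ, h])
  have hψx : ψ x = TenPoints.transl := by
    ext1 v
    refine hψ' _ _ _ ?_
    rcases v with _ | v
    · exact Sylow.smul_eq_iff_mem_normalizer.2 (Subgroup.le_normalizer hx)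
    · have h1 : x = e (.ofAdd (1, 0)) := by
        show x = x ^ (1 : ZMod 3).val * y ^ (0 : ZMod 3).val
        rw [ZMod.val_one, ZMod.val_zero, pow_one, pow_zero, mul_one]
      have h2 : TenPoints.transl (some v) = some ((1, 0) + v) := by
        obtain ⟨a, b⟩ := v
        simp [TenPoints.transl, add_comm]
      rw [h2]
      show x • e (.ofAdd v) • Q = e (.ofAdd ((1, 0) + v)) • Q
      rw [ofAdd_add, map_mul, ← h1, mul_smul]
  have hψt : ψ t = TenPoints.rot := by
    ext1 v
    refine hψ' _ _ _ ?_
    rcases v with _ | v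
    · exact htP
    · have h1 : t * e (.ofAdd v) = e (.ofAdd (-v.2, v.1)) * t :=
        mul_pow_mul_pow_eq hcomm x3 rfl (hG.conj_conj_eq_inv P htN ht hx) v
      show t • e (.ofAdd v) • Q = e (.ofAdd (-v.2, v.1)) • Q
      rw [← mul_smul, h1, mul_smul, htQ]
  have hf0 : f (some (0, 0)) = Q := by
    show e 1 • Q = Q
    rw [map_one, one_smul]
  have hpow : ∀ k : ℕ, (t ^ k) • P = P ∧ (t ^ k) • Q = Q := fun k =>
    ⟨MulAction.mem_stabilizer_iff.1 (pow_mem (MulAction.mem_stabilizer_iff.2 htP) k),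
      MulAction.mem_stabilizer_iff.1 (pow_mem (MulAction.mem_stabilizer_iff.2 htQ) k)⟩
  have hwt : ∀ k : ℕ, (w * t ^ k) • P = Q ∧ (w * t ^ k) • Q = P := fun k =>
    ⟨by rw [mul_smul, (hpow k).1, hwP], by rw [mul_smul, (hpow k).2, hwQ]⟩
  have hsq : ∀ k : ℕ, (w * t ^ k) ^ 2 = 1 := fun k =>
    hG.sq_eq_one_of_swap hQ ht htP htQ (hwt k).1 (hwt k).2
  have w2 : w ^ 2 = 1 := by simpa using hsq 0
  have hwtw : w * t = t⁻¹ * w := by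
    have h1 := hsq 1
    rw [pow_one, pow_two] at h1
    have h2 : w⁻¹ = w := inv_eq_of_mul_eq_one_right (by rw [← pow_two, w2])
    rw [← inv_eq_of_mul_eq_one_right h1, mul_inv_rev, h2]
  have hsf := TenPoints.eq_swapFun (ψ w) (hψ' _ _ _ (by rw [hf0]; exact hwP))
    (hψ' _ _ _ (by rw [hf0]; exact hwQ)) (fun v => by
      rw [← hψt, ← Equiv.Perm.mul_apply, ← map_mul, hwtw, map_mul, map_inv]; rfl)
  have hit : ∀ (σ : Equiv.Perm TenPoints) (n : ℕ), (σ : TenPoints → TenPoints)^[n] = ⇑(σ ^ n) :=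
    fun σ n => (Equiv.Perm.coe_pow σ n).symm
  obtain ⟨j, hj⟩ := TenPoints.exists_swapFun_eq_inversion _ _ (fun v => by
      rw [← hsf, ← Equiv.Perm.mul_apply, ← map_mul, ← pow_two, w2, map_one]; rfl)
    (fun j i => by
      rw [← hsf, hit, hit, ← Equiv.Perm.coe_mul, ← Equiv.Perm.coe_mul, ← Equiv.Perm.coe_mul,
        hit, hit, hit, ← hψx, ← hψt]
      simp only [← map_mul, ← map_pow]
      rcases delta2_holdsIn_iff.1 (satisfies_sevenFormulas_iff.1 hG).2.1
        (x * (t ^ i.1 * (w * t ^ j.1))) with h | h | h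
      · exact Or.inl fun v => by rw [h, map_one]; rfl
      · exact Or.inr (Or.inl fun v => by rw [h, map_one]; rfl)
      · exact Or.inr (Or.inr fun v => by rw [h, map_one]; rfl))
  have hψw : ψ (w * t ^ j.1) = TenPoints.inversion := by
    ext1 v
    rw [← hj, ← hsf, hit, map_mul, map_pow, hψt]; rfl
  refine ⟨ψ, hψinj, ?_⟩
  have htop : Subgroup.closure {x, t, w * t ^ j.1} = ⊤ := by
    have hxM : x ∈ Subgroup.closure {x, t, w * t ^ j.1} := Subgroup.subset_closure (by simp)
    have htM : t ∈ Subgroup.closure {x, t, w * t ^ j.1} := Subgroup.subset_closure (by simp)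
    refine hG.closure_eq_top hc hN ht htN (w := w * t ^ j.1) (fun h => ?_) _ ?_ htM
      (Subgroup.subset_closure (by simp))
    · rw [← Sylow.smul_eq_iff_mem_normalizer, (hwt j).1] at h
      exact hQ h.symm
    · have h1 : e.range ≤ P := by
        rintro _ ⟨v, rfl⟩; exact he v
      have h2 : e.range = P := Subgroup.eq_of_le_of_card_ge h1 (by
        rw [← Nat.card_congr (MonoidHom.ofInjective heinj).toEquiv]
        refine (le_of_eq hP).trans ?_
        simp [Nat.card_eq_fintype_card, ZMod.card])
      rw [← h2]
      rintro _ ⟨v, rfl⟩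
      exact mul_mem (pow_mem hxM _)
        (pow_mem (mul_mem (mul_mem htM hxM) (inv_mem htM)) _)
  rw [MonoidHom.range_eq_map, ← htop, MonoidHom.map_closure, Set.image_insert_eq, Set.image_pair,
    hψx, hψt, hψw]

end Satisfies

/-- Permutations of six points, coded by natural numbers in base `8`. -/
def PermCode.enc (a b c d e f : ℕ) : ℕ := a + 8 * b + 64 * c + 512 * d + 4096 * e + 32768 * f

namespace PermCode

/-- The `i`-th digit of `x`. -/
def digit (x i : ℕ) : ℕ := Nat.mod (Nat.div x (Nat.pow 8 i)) 8

/-- The code of a product. -/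
def mul (x y : ℕ) : ℕ :=
  enc (digit x (digit y 0)) (digit x (digit y 1)) (digit x (digit y 2)) (digit x (digit y 3))
    (digit x (digit y 4)) (digit x (digit y 5))

/-- The code of a permutation. -/
def code (σ : Equiv.Perm (Fin 6)) : ℕ := enc (σ 0) (σ 1) (σ 2) (σ 3) (σ 4) (σ 5)

theorem digit_enc {a b c d e f : ℕ} (ha : a < 8) (hb : b < 8) (hc : c < 8) (hd : d < 8)
    (he : e < 8) (hf : f < 8) : digit (enc a b c d e f) 0 = a ∧ digit (enc a b c d e f) 1 = b ∧
    digit (enc a b c d e f) 2 = c ∧ digit (enc a b c d e f) 3 = d ∧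
    digit (enc a b c d e f) 4 = e ∧ digit (enc a b c d e f) 5 = f := by
  have h : ∀ x i, digit x i = x / 8 ^ i % 8 := fun _ _ => rfl
  simp only [h, enc]
  omega

theorem digit_code (σ : Equiv.Perm (Fin 6)) (i : Fin 6) : digit (code σ) i = σ i := by
  have hlt : ∀ j, (σ j : ℕ) < 8 := fun j => (σ j).2.trans (by norm_num)
  have h := digit_enc (hlt 0) (hlt 1) (hlt 2) (hlt 3) (hlt 4) (hlt 5)
  fin_cases i
  exacts [h.1, h.2.1, h.2.2.1, h.2.2.2.1, h.2.2.2.2.1, h.2.2.2.2.2]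

theorem code_mul (σ τ : Equiv.Perm (Fin 6)) : code (σ * τ) = mul (code σ) (code τ) := by
  have h : ∀ i : Fin 6, digit (code σ) (digit (code τ) i) = (σ * τ) i := fun i => by
    rw [digit_code, digit_code]; rfl
  have e0 : digit (code σ) (digit (code τ) 0) = (σ * τ) 0 := h 0
  have e1 : digit (code σ) (digit (code τ) 1) = (σ * τ) 1 := h 1
  have e2 : digit (code σ) (digit (code τ) 2) = (σ * τ) 2 := h 2
  have e3 : digit (code σ) (digit (code τ) 3) = (σ * τ) 3 := h 3
  have e4 : digit (code σ) (digit (code τ) 4) = (σ * τ) 4 := h 4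
  have e5 : digit (code σ) (digit (code τ) 5) = (σ * τ) 5 := h 5
  rw [mul, e0, e1, e2, e3, e4, e5]
  rfl

theorem code_injective : Function.Injective code := fun σ τ h => by
  ext i
  rw [← digit_code, ← digit_code, h]

/-- Whether `x` codes the identity. -/
def isId (x : ℕ) : Bool := Nat.beq x (enc 0 1 2 3 4 5)

theorem isId_code {σ : Equiv.Perm (Fin 6)} : isId (code σ) = true ↔ σ = 1 := by
  have : code 1 = enc 0 1 2 3 4 5 := rfl
  rw [isId, Nat.beq_eq, ← this, code_injective.eq_iff]

theorem beq_code {σ τ : Equiv.Perm (Fin 6)} : Nat.beq (code σ) (code τ) = true ↔ σ = τ := by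
  rw [Nat.beq_eq, code_injective.eq_iff]

/-- Whether the cube of the permutation is trivial. -/
def cube (x : ℕ) : Bool := isId (mul x (mul x x))

/-- Whether the fourth power of the permutation is trivial. -/
def fourth (x : ℕ) : Bool := isId (mul (mul x x) (mul x x))

/-- Whether the fifth power of the permutation is trivial. -/
def fifth (x : ℕ) : Bool := isId (mul x (mul (mul x x) (mul x x)))

theorem cube_code {σ : Equiv.Perm (Fin 6)} : cube (code σ) = true ↔ σ ^ 3 = 1 := by
  rw [cube, ← code_mul, ← code_mul, isId_code, pow_succ', pow_two]

theorem fourth_code {σ : Equiv.Perm (Fin 6)} : fourth (code σ) = true ↔ σ ^ 4 = 1 := by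
  rw [fourth, ← code_mul, ← code_mul, isId_code, ← pow_two, ← pow_two, ← pow_mul]

theorem fifth_code {σ : Equiv.Perm (Fin 6)} : fifth (code σ) = true ↔ σ ^ 5 = 1 := by
  rw [fifth, ← code_mul, ← code_mul, ← code_mul, isId_code, ← pow_two, ← pow_two, ← pow_mul,
    ← pow_succ']

/-- The parity of the number of inversions among the digits, `true` if it is even. -/
def even (a b c d e f : ℕ) : Bool :=
  !xor (xor (xor (xor (Nat.blt b a) (Nat.blt c a)) (xor (Nat.blt d a) (Nat.blt e a)))
    (xor (xor (Nat.blt f a) (Nat.blt c b)) (xor (Nat.blt d b) (Nat.blt e b))))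
    (xor (xor (xor (Nat.blt f b) (Nat.blt d c)) (xor (Nat.blt e c) (Nat.blt f c)))
    (xor (xor (Nat.blt e d) (Nat.blt f d)) (Nat.blt f e)))

theorem even_of_sign : ∀ σ : Equiv.Perm (Fin 6), Equiv.Perm.sign σ = 1 →
    even (σ 0) (σ 1) (σ 2) (σ 3) (σ 4) (σ 5) = true := by
  decide +kernel

/-- The conjunction of `p` over `0, …, 5`. -/
def all6 (p : ℕ → Bool) : Bool := p 0 && p 1 && p 2 && p 3 && p 4 && p 5

theorem all6_spec {p : ℕ → Bool} (h : all6 p = true) (i : Fin 6) : p i = true := by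
  simp only [all6, Bool.and_eq_true] at h
  obtain ⟨⟨⟨⟨⟨h0, h1⟩, h2⟩, h3⟩, h4⟩, h5⟩ := h
  fin_cases i
  exacts [h0, h1, h2, h3, h4, h5]

/-- Whether `p` holds for the codes of all even permutations. -/
def allEven (p : ℕ → Bool) : Bool :=
  all6 fun a => all6 fun b => Nat.beq a b || all6 fun c => (Nat.beq a c || Nat.beq b c) ||
    all6 fun d => (Nat.beq a d || Nat.beq b d || Nat.beq c d) ||
    all6 fun e => (Nat.beq a e || Nat.beq b e || Nat.beq c e || Nat.beq d e) ||
    all6 fun f => (Nat.beq a f || Nat.beq b f || Nat.beq c f || Nat.beq d f || Nat.beq e f) ||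
      !even a b c d e f || p (enc a b c d e f)

theorem allEven_spec {p : ℕ → Bool} (h : allEven p = true) {σ : Equiv.Perm (Fin 6)}
    (hσ : Equiv.Perm.sign σ = 1) : p (code σ) = true := by
  have hne : ∀ i j : Fin 6, i ≠ j → Nat.beq (σ i) (σ j) = false := fun i j hij => by
    rw [Bool.eq_false_iff, Ne, Nat.beq_eq]
    exact fun h => hij (σ.injective (Fin.ext h))
  have h := all6_spec h (σ 0)
  have h := all6_spec (by simpa only [hne 0 1 (by decide), Bool.false_or] using all6_spec h (σ 1))
    (σ 2)
  simp only [hne 0 2 (by decide), hne 1 2 (by decide), Bool.false_or] at h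
  have h := all6_spec h (σ 3)
  simp only [hne 0 3 (by decide), hne 1 3 (by decide), hne 2 3 (by decide), Bool.false_or] at h
  have h := all6_spec h (σ 4)
  simp only [hne 0 4 (by decide), hne 1 4 (by decide), hne 2 4 (by decide), hne 3 4 (by decide),
    Bool.false_or] at h
  have h := all6_spec h (σ 5)
  simp only [hne 0 5 (by decide), hne 1 5 (by decide), hne 2 5 (by decide), hne 3 5 (by decide),
    hne 4 5 (by decide), Bool.false_or, even_of_sign σ hσ, Bool.not_true] at h
  exact h

end PermCode

namespace SixPoints

open Equiv.Perm

local notation "S₆" => Equiv.Perm (Fin 6)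

theorem sum_cycleType_le_six (σ : S₆) : σ.cycleType.sum ≤ 6 := by
  simpa using sum_cycleType_le σ

theorem cycleType_of_orderOf_eq_five {σ : S₆} (h : orderOf σ = 5) : σ.cycleType = {5} := by
  obtain ⟨n, hn⟩ := cycleType_prime_order (σ := σ) (by rw [h]; norm_num)
  have hs := sum_cycleType_le_six σ
  rw [hn, h, Multiset.sum_replicate, smul_eq_mul] at hs
  obtain rfl : n = 0 := by omega
  rw [hn, h]; rfl

theorem cycleType_of_orderOf_eq_two {σ : S₆} (h : orderOf σ = 2) (hs : sign σ = 1) :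
    σ.cycleType = {2, 2} := by
  obtain ⟨n, hn⟩ := cycleType_prime_order (σ := σ) (by rw [h]; norm_num)
  have hsum := sum_cycleType_le_six σ
  have hsg := sign_of_cycleType σ
  rw [hs] at hsg
  rw [hn, h, Multiset.sum_replicate, smul_eq_mul] at hsum hsg
  have hn3 : n ≤ 2 := by omega
  interval_cases n
  · exact absurd hsg (by decide)
  · rw [hn, h]; rfl
  · exact absurd hsg (by decide)

theorem cycleType_of_orderOf_eq_three {σ : S₆} (h : orderOf σ = 3) :
    σ.cycleType = {3} ∧ (∃ i, σ i = i) ∨ σ.cycleType = {3, 3} ∧ ∀ i, σ i ≠ i := by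
  obtain ⟨n, hn⟩ := cycleType_prime_order (σ := σ) (by rw [h]; norm_num)
  have hsum := sum_cycleType_le_six σ
  have hsupp := sum_cycleType σ
  rw [hn, h, Multiset.sum_replicate, smul_eq_mul] at hsum hsupp
  have hn3 : n ≤ 1 := by omega
  interval_cases n
  · refine Or.inl ⟨by rw [hn, h]; rfl, ?_⟩
    by_contra! hf
    have : σ.support = Finset.univ :=
      Finset.eq_univ_iff_forall.2 fun i => Equiv.Perm.mem_support.2 (hf i)
    rw [this] at hsupp
    simp at hsupp
  · refine Or.inr ⟨by rw [hn, h]; rfl, fun i => ?_⟩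
    have : σ.support = Finset.univ := Finset.eq_univ_of_card _ (by rw [← hsupp]; rfl)
    exact Equiv.Perm.mem_support.1 (this ▸ Finset.mem_univ i)

theorem cycleType_of_orderOf_eq_four {σ : S₆} (h : orderOf σ = 4) (hs : sign σ = 1) :
    σ.cycleType = {4, 2} := by
  have hmem : ∀ n ∈ σ.cycleType, n = 2 ∨ n = 4 := fun n hn => by
    have h1 := two_le_of_mem_cycleType hn
    have h2 := dvd_of_mem_cycleType hn
    rw [h] at h2
    have := Nat.le_of_dvd (by norm_num) h2
    interval_cases n <;> omega
  have h4 : 4 ∈ σ.cycleType := by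
    by_contra h4
    have h2 : orderOf σ ∣ 2 := by
      rw [← lcm_cycleType, Multiset.lcm_dvd]
      intro n hn
      rcases hmem n hn with rfl | rfl
      · exact dvd_rfl
      · exact absurd hn h4
    rw [h] at h2
    omega
  obtain ⟨m, hm⟩ := Multiset.exists_cons_of_mem h4
  have hsum := sum_cycleType_le_six σ
  have hsg := sign_of_cycleType σ
  rw [hs, hm] at hsg
  rw [hm, Multiset.sum_cons] at hsum
  rw [hm] at hmem ⊢
  rcases Multiset.empty_or_exists_mem m with rfl | ⟨a, ha⟩
  · exact absurd hsg (by decide)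
  · obtain ⟨m', rfl⟩ := Multiset.exists_cons_of_mem ha
    rw [Multiset.sum_cons] at hsum
    obtain rfl : a = 2 := by
      rcases hmem a (by simp) with h1 | h1 <;> omega
    rcases Multiset.empty_or_exists_mem m' with rfl | ⟨b, hb⟩
    · rfl
    · obtain ⟨m'', rfl⟩ := Multiset.exists_cons_of_mem hb
      rw [Multiset.sum_cons] at hsum
      rcases hmem b (by simp) with h1 | h1 <;> omega

/-- A permutation of cycle type `(5)`. -/
def five : S₆ := c[0, 1, 2, 3, 4]

/-- A permutation of cycle type `(4, 2)`. -/
def fourTwo : S₆ := c[0, 1, 2, 3] * c[4, 5]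

/-- A permutation of cycle type `(2, 2)`. -/
def twoTwo : S₆ := c[0, 1] * c[2, 3]

/-- A permutation of cycle type `(3)`. -/
def three : S₆ := c[0, 1, 2]

/-- A permutation of cycle type `(3, 3)`. -/
def threeThree : S₆ := c[0, 1, 2] * c[3, 4, 5]

theorem code_five : PermCode.code five = PermCode.enc 1 2 3 4 0 5 := by decide
theorem code_fourTwo : PermCode.code fourTwo = PermCode.enc 1 2 3 0 5 4 := by decide
theorem code_twoTwo : PermCode.code twoTwo = PermCode.enc 1 0 3 2 4 5 := by decide
theorem code_three : PermCode.code three = PermCode.enc 1 2 0 3 4 5 := by decide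
theorem code_threeThree : PermCode.code threeThree = PermCode.enc 1 2 0 4 5 3 := by decide

theorem exists_conj_eq_five {σ : S₆} (h : orderOf σ = 5) : ∃ c : S₆, c * σ * c⁻¹ = five :=
  isConj_iff.1 <| isConj_of_cycleType_eq <| by
    rw [cycleType_of_orderOf_eq_five h, cycleType_of_orderOf_eq_five]
    exact orderOf_eq_prime (by decide +kernel) (by decide +kernel)

theorem exists_conj_eq_fourTwo {σ : S₆} (h : orderOf σ = 4) (hs : sign σ = 1) :
    ∃ c : S₆, c * σ * c⁻¹ = fourTwo :=
  isConj_iff.1 <| isConj_of_cycleType_eq <| by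
    rw [cycleType_of_orderOf_eq_four h hs, cycleType_of_orderOf_eq_four]
    · exact orderOf_eq_prime_pow (p := 2) (n := 1) (by decide +kernel) (by decide +kernel)
    · decide +kernel

theorem exists_conj_eq_twoTwo {σ : S₆} (h : orderOf σ = 2) (hs : sign σ = 1) :
    ∃ c : S₆, c * σ * c⁻¹ = twoTwo :=
  isConj_iff.1 <| isConj_of_cycleType_eq <| by
    rw [cycleType_of_orderOf_eq_two h hs, cycleType_of_orderOf_eq_two]
    · exact orderOf_eq_prime (by decide +kernel) (by decide +kernel)
    · decide +kernel

theorem exists_conj_eq_three {σ : S₆} (h : orderOf σ = 3) :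
    (∃ c : S₆, c * σ * c⁻¹ = three) ∨ ∃ c : S₆, c * σ * c⁻¹ = threeThree := by
  have h3 : orderOf three = 3 := orderOf_eq_prime (by decide +kernel) (by decide +kernel)
  have h33 : orderOf threeThree = 3 := orderOf_eq_prime (by decide +kernel) (by decide +kernel)
  rcases cycleType_of_orderOf_eq_three h with ⟨h1, -⟩ | ⟨h1, -⟩
  · refine Or.inl (isConj_iff.1 (isConj_of_cycleType_eq ?_))
    rcases cycleType_of_orderOf_eq_three h3 with ⟨h2, -⟩ | ⟨-, h2⟩
    · rw [h1, h2]
    · exact absurd (by decide) (h2 5)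
  · refine Or.inr (isConj_iff.1 (isConj_of_cycleType_eq ?_))
    rcases cycleType_of_orderOf_eq_three h33 with ⟨-, h2⟩ | ⟨h2, -⟩
    · exact absurd h2 (by decide)
    · rw [h1, h2]

open PermCode

theorem pow_twelve_of_code {w : S₆} (h : (cube (code w) || fourth (code w)) = true) :
    w ^ 12 = 1 := by
  rw [Bool.or_eq_true, cube_code, fourth_code] at h
  rcases h with h | h
  · rw [show 12 = 3 * 4 from rfl, pow_mul, h, one_pow]
  · rw [show 12 = 4 * 3 from rfl, pow_mul, h, one_pow]

theorem pow_fifteen_of_code {w : S₆} (h : (cube (code w) || fifth (code w)) = true) :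
    w ^ 15 = 1 := by
  rw [Bool.or_eq_true, cube_code, fifth_code] at h
  rcases h with h | h
  · rw [show 15 = 3 * 5 from rfl, pow_mul, h, one_pow]
  · rw [show 15 = 5 * 3 from rfl, pow_mul, h, one_pow]

theorem pow_twenty_of_code {w : S₆} (h : (fourth (code w) || fifth (code w)) = true) :
    w ^ 20 = 1 := by
  rw [Bool.or_eq_true, fourth_code, fifth_code] at h
  rcases h with h | h
  · rw [show 20 = 4 * 5 from rfl, pow_mul, h, one_pow]
  · rw [show 20 = 5 * 4 from rfl, pow_mul, h, one_pow]

theorem pow_cases {a : S₆} (ha : sign a = 1) : a ^ 3 = 1 ∨ a ^ 4 = 1 ∨ a ^ 5 = 1 := by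
  have h := allEven_spec (p := fun b => cube b || fourth b || fifth b) (by decide +kernel) ha
  simpa only [Bool.or_eq_true, cube_code, fourth_code, fifth_code, or_assoc] using h

theorem orderOf_eq_five {a : S₆} (ha : sign a = 1) (h : a ^ 12 ≠ 1) : orderOf a = 5 := by
  have h1 : a ≠ 1 := fun h1 => h (by rw [h1, one_pow])
  rcases pow_cases ha with h3 | h4 | h5
  · exact absurd (by rw [show 12 = 3 * 4 from rfl, pow_mul, h3, one_pow]) h
  · exact absurd (by rw [show 12 = 4 * 3 from rfl, pow_mul, h4, one_pow]) h
  · exact orderOf_eq_prime h5 h1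

theorem orderOf_eq_three {a : S₆} (ha : sign a = 1) (h : a ^ 20 ≠ 1) : orderOf a = 3 := by
  have h1 : a ≠ 1 := fun h1 => h (by rw [h1, one_pow])
  rcases pow_cases ha with h3 | h4 | h5
  · exact orderOf_eq_prime h3 h1
  · exact absurd (by rw [show 20 = 4 * 5 from rfl, pow_mul, h4, one_pow]) h
  · exact absurd (by rw [show 20 = 5 * 4 from rfl, pow_mul, h5, one_pow]) h

theorem orderOf_eq_two_or_four {a : S₆} (ha : sign a = 1) (h : a ^ 15 ≠ 1) :
    orderOf a = 2 ∨ orderOf a = 4 := by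
  have h1 : a ≠ 1 := fun h1 => h (by rw [h1, one_pow])
  rcases pow_cases ha with h3 | h4 | h5
  · exact absurd (by rw [show 15 = 3 * 5 from rfl, pow_mul, h3, one_pow]) h
  · by_cases h2 : a ^ 2 = 1
    · exact Or.inl (orderOf_eq_prime h2 h1)
    · exact Or.inr (orderOf_eq_prime_pow (p := 2) (n := 1) (by simpa using h2) h4)
  · exact absurd (by rw [show 15 = 5 * 3 from rfl, pow_mul, h5, one_pow]) h

theorem orderOf_eq_four {a : S₆} (ha : sign a = 1) (h : a ^ 30 ≠ 1) : orderOf a = 4 := by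
  rcases orderOf_eq_two_or_four ha
    (fun h' => h (by rw [show 30 = 15 * 2 from rfl, pow_mul, h', one_pow])) with h1 | h1
  · refine absurd ?_ h
    rw [show 30 = 2 * 15 from rfl, pow_mul, ← h1, pow_orderOf_eq_one, one_pow]
  · exact h1

theorem sign_conj_eq {b : S₆} (hb : sign b = 1) (c : S₆) : sign (MulAut.conj c b) = 1 := by
  simp [hb]

theorem delta7_perm {a b : S₆} (ha : sign a = 1) (hb : sign b = 1) :
    a ^ 12 = 1 ∨ b ^ 12 = 1 ∨ (a * b) ^ 12 = 1 ∨
      (a * b ^ 2) ^ 12 = 1 ∨ (a * b ^ 3) ^ 12 = 1 ∨ (a * b ^ 4) ^ 12 = 1 := by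
  refine or_iff_not_imp_left.2 fun h => ?_
  obtain ⟨c, hc⟩ := exists_conj_eq_five (orderOf_eq_five ha h)
  have key : ∀ b : S₆, sign b = 1 → b ^ 12 = 1 ∨ (five * b) ^ 12 = 1 ∨
      (five * b ^ 2) ^ 12 = 1 ∨ (five * b ^ 3) ^ 12 = 1 ∨ (five * b ^ 4) ^ 12 = 1 := by
    intro b hb
    let o : ℕ → Bool := fun w => cube w || fourth w
    let p : ℕ → Bool := fun b => o b || o (mul (enc 1 2 3 4 0 5) b) ||
      o (mul (enc 1 2 3 4 0 5) (mul b b)) || o (mul (enc 1 2 3 4 0 5) (mul b (mul b b))) ||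
      o (mul (enc 1 2 3 4 0 5) (mul (mul b b) (mul b b)))
    have h := allEven_spec (p := p) (by decide +kernel) hb
    simp only [p, ← code_five, ← code_mul] at h
    rw [Bool.or_eq_true, Bool.or_eq_true, Bool.or_eq_true, Bool.or_eq_true] at h
    rw [pow_succ' b 2, pow_two, show b ^ 4 = b * b * (b * b) by rw [← pow_two, ← pow_two, ← pow_mul]]
    rcases h with (((h | h) | h) | h) | h
    · exact Or.inl (pow_twelve_of_code h)
    · exact Or.inr (Or.inl (pow_twelve_of_code h))
    · exact Or.inr (Or.inr (Or.inl (pow_twelve_of_code h)))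
    · exact Or.inr (Or.inr (Or.inr (Or.inl (pow_twelve_of_code h))))
    · exact Or.inr (Or.inr (Or.inr (Or.inr (pow_twelve_of_code h))))
  have h := key (MulAut.conj c b) (sign_conj_eq hb c)
  rw [← hc, ← MulAut.conj_apply] at h
  simpa only [← map_mul, ← map_pow, EmbeddingLike.map_eq_one_iff] using h

theorem delta4_perm {a b : S₆} (ha : sign a = 1) (hb : sign b = 1) :
    a ^ 30 = 1 ∨ b ^ 30 = 1 ∨ (a * b) ^ 15 = 1 ∨
      (a * b ^ 2) ^ 15 = 1 ∨ (a * b ^ 3) ^ 15 = 1 := by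
  refine or_iff_not_imp_left.2 fun h => ?_
  refine or_iff_not_imp_left.2 fun h' => ?_
  obtain ⟨c, hc⟩ := exists_conj_eq_fourTwo (orderOf_eq_four ha h) ha
  have key : ∀ b : S₆, sign b = 1 → orderOf b = 4 → (fourTwo * b) ^ 15 = 1 ∨
      (fourTwo * b ^ 2) ^ 15 = 1 ∨ (fourTwo * b ^ 3) ^ 15 = 1 := by
    intro b hb hb4
    let o : ℕ → Bool := fun w => cube w || fifth w
    let p : ℕ → Bool := fun b => !fourth b || isId (mul b b) || o (mul (enc 1 2 3 0 5 4) b) ||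
      o (mul (enc 1 2 3 0 5 4) (mul b b)) || o (mul (enc 1 2 3 0 5 4) (mul b (mul b b)))
    have h := allEven_spec (p := p) (by decide +kernel) hb
    have h1 : fourth (code b) = true := fourth_code.2 (hb4 ▸ pow_orderOf_eq_one b)
    have h2 : isId (code (b * b)) = false := by
      rw [Bool.eq_false_iff, Ne, isId_code, ← pow_two]
      intro h2
      have := orderOf_dvd_of_pow_eq_one h2
      rw [hb4] at this
      omega
    simp only [p, ← code_fourTwo, ← code_mul, h1, h2, Bool.not_true, Bool.false_or] at h
    rw [Bool.or_eq_true, Bool.or_eq_true] at h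
    rw [pow_succ' b 2, pow_two]
    rcases h with (h | h) | h
    · exact Or.inl (pow_fifteen_of_code h)
    · exact Or.inr (Or.inl (pow_fifteen_of_code h))
    · exact Or.inr (Or.inr (pow_fifteen_of_code h))
  have h := key (MulAut.conj c b) (sign_conj_eq hb c)
    (by rw [MulEquiv.orderOf_eq, orderOf_eq_four hb h'])
  rw [← hc, ← MulAut.conj_apply] at h
  simpa only [← map_mul, ← map_pow, EmbeddingLike.map_eq_one_iff] using h

theorem delta6_perm {a b : S₆} (ha : sign a = 1) (hb : sign b = 1) :
    a ^ 12 = 1 ∨ b ^ 30 = 1 ∨ (a * (b⁻¹ * a * b)) ^ 12 = 1 ∨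
      (a * (b⁻¹ * a ^ 3 * b)) ^ 12 = 1 ∨ (a ^ 2 * (b⁻¹ * a * b)) ^ 12 = 1 := by
  refine or_iff_not_imp_left.2 fun h => ?_
  refine or_iff_not_imp_left.2 fun h' => ?_
  obtain ⟨c, hc⟩ := exists_conj_eq_five (orderOf_eq_five ha h)
  have key : ∀ b : S₆, sign b = 1 → orderOf b = 4 → (five * (b⁻¹ * five * b)) ^ 12 = 1 ∨
      (five * (b⁻¹ * five ^ 3 * b)) ^ 12 = 1 ∨ (five ^ 2 * (b⁻¹ * five * b)) ^ 12 = 1 := by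
    intro b hb hb4
    let r := enc 1 2 3 4 0 5
    let o : ℕ → Bool := fun w => cube w || fourth w
    let p : ℕ → Bool := fun b => !fourth b || isId (mul b b) ||
      o (mul r (mul (mul (mul b (mul b b)) r) b)) ||
      o (mul r (mul (mul (mul b (mul b b)) (mul r (mul r r))) b)) ||
      o (mul (mul r r) (mul (mul (mul b (mul b b)) r) b))
    have h := allEven_spec (p := p) (by decide +kernel) hb
    have h1 : fourth (code b) = true := fourth_code.2 (hb4 ▸ pow_orderOf_eq_one b)
    have h2 : isId (code (b * b)) = false := by
      rw [Bool.eq_false_iff, Ne, isId_code, ← pow_two]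
      intro h2
      have := orderOf_dvd_of_pow_eq_one h2
      rw [hb4] at this
      omega
    simp only [p, r, ← code_five, ← code_mul, h1, h2, Bool.not_true, Bool.false_or] at h
    have hinv : b⁻¹ = b * (b * b) := by
      rw [inv_eq_iff_mul_eq_one, ← pow_two, ← pow_succ', ← pow_succ']
      exact orderOf_dvd_iff_pow_eq_one.1 (hb4 ▸ dvd_rfl)
    rw [Bool.or_eq_true, Bool.or_eq_true] at h
    rw [pow_succ' five 2, pow_two, hinv]
    rcases h with (h | h) | h
    · exact Or.inl (pow_twelve_of_code h)
    · exact Or.inr (Or.inl (pow_twelve_of_code h))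
    · exact Or.inr (Or.inr (pow_twelve_of_code h))
  have h := key (MulAut.conj c b) (sign_conj_eq hb c)
    (by rw [MulEquiv.orderOf_eq, orderOf_eq_four hb h'])
  rw [← hc, ← MulAut.conj_apply] at h
  simpa only [← map_mul, ← map_pow, ← map_inv, EmbeddingLike.map_eq_one_iff] using h

theorem exists_of_conj_eq {g : ℕ → S₆} (hg : ∀ i, sign (g i) = 1) {r c : S₆}
    (hc : c * g 1 * c⁻¹ = r) (l : List ℕ) (hl : l.toFinset.card < 8)
    (h : allEven (fun b => (fourth b || fifth b) ||
      (fourth (mul (code r) b) || fifth (mul (code r) b)) ||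
      (fourth (mul (code r) (mul b b)) || fifth (mul (code r) (mul b b))) || l.contains b) = true) :
    (∃ i, 1 ≤ i ∧ i ≤ 9 ∧ g i ^ 20 = 1) ∨ ∃ i j, 1 ≤ i ∧ i < j ∧ j ≤ 9 ∧
      (g i = g j ∨ (g i * g j) ^ 20 = 1 ∨ (g i * g j ^ 2) ^ 20 = 1) := by
  by_contra! hcon
  obtain ⟨h1, h2⟩ := hcon
  have hmem : ∀ j ∈ Finset.Icc 2 9, code (MulAut.conj c (g j)) ∈ l.toFinset := by
    intro j hj
    rw [Finset.mem_Icc] at hj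
    have h3 := allEven_spec h (sign_conj_eq (hg j) c)
    have h4 := h2 1 j le_rfl (by omega) hj.2
    have h5 : ∀ w, (MulAut.conj c w) ^ 20 = 1 → w ^ 20 = 1 := fun w hw => by
      rwa [← map_pow, EmbeddingLike.map_eq_one_iff] at hw
    rw [← hc, ← MulAut.conj_apply, ← code_mul, ← code_mul, ← code_mul, ← map_mul, ← map_mul,
      ← map_mul, ← pow_two] at h3
    rw [Bool.or_eq_true, Bool.or_eq_true, Bool.or_eq_true] at h3
    rw [List.mem_toFinset]
    rcases h3 with ((h3 | h3) | h3) | h3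
    · exact absurd (h5 _ (pow_twenty_of_code h3)) (h1 j (by omega) hj.2)
    · exact absurd (h5 _ (pow_twenty_of_code h3)) h4.2.1
    · exact absurd (h5 _ (pow_twenty_of_code h3)) h4.2.2
    · exact List.contains_iff_mem.1 h3
  obtain ⟨i, hi, j, hj, hij, heq⟩ := Finset.exists_ne_map_eq_of_card_lt_of_maps_to
    (s := Finset.Icc 2 9) (t := l.toFinset) (by simpa using hl) hmem
  have heq' : g i = g j := (MulAut.conj c).injective (code_injective heq)
  rw [Finset.mem_Icc] at hi hj
  rcases lt_or_gt_of_ne hij with hlt | hlt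
  · exact (h2 i j (by omega) hlt hj.2).1 heq'
  · exact (h2 j i (by omega) hlt hi.2).1 heq'.symm

theorem delta3_perm {g : ℕ → S₆} (hg : ∀ i, sign (g i) = 1) :
    (∃ i, 1 ≤ i ∧ i ≤ 9 ∧ g i ^ 20 = 1) ∨ ∃ i j, 1 ≤ i ∧ i < j ∧ j ≤ 9 ∧
      (g i = g j ∨ (g i * g j) ^ 20 = 1 ∨ (g i * g j ^ 2) ^ 20 = 1) := by
  by_cases h : g 1 ^ 20 = 1
  · exact Or.inl ⟨1, le_rfl, by norm_num, h⟩
  rcases exists_conj_eq_three (orderOf_eq_three (hg 1) h) with ⟨c, hc⟩ | ⟨c, hc⟩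
  · refine exists_of_conj_eq hg hc [120849, 120898, 120968, 145937, 145986, 146056] (by decide) ?_
    rw [code_three]; decide +kernel
  · refine exists_of_conj_eq hg hc [120898, 120968, 145937, 146056, 181777, 181826] (by decide) ?_
    rw [code_threeThree]; decide +kernel

/-- Whether the products `uv, uv², uv³` are all of even order. -/
def evenProducts (u v : ℕ) : Bool :=
  !(cube (mul u v) || fifth (mul u v)) && !(cube (mul u (mul v v)) || fifth (mul u (mul v v))) &&
    !(cube (mul u (mul v (mul v v))) || fifth (mul u (mul v (mul v v))))

theorem evenProducts_code {u v : S₆} (h : ¬ ((u * v) ^ 15 = 1 ∨ (u * v ^ 2) ^ 15 = 1 ∨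
    (u * v ^ 3) ^ 15 = 1)) : evenProducts (code u) (code v) = true := by
  push Not at h
  rw [pow_succ' v 2, pow_two] at h
  have h' : ∀ w : S₆, w ^ 15 ≠ 1 → (!(cube (code w) || fifth (code w))) = true := fun w hw => by
    rw [Bool.not_eq_true', Bool.eq_false_iff]
    exact fun h1 => hw (pow_fifteen_of_code h1)
  simp only [evenProducts, ← code_mul]
  rw [Bool.and_eq_true, Bool.and_eq_true]
  exact ⟨⟨h' _ h.1, h' _ h.2.1⟩, h' _ h.2.2⟩

/-- Whether `u` is one of `1, v, v², v³`. -/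
def inCycCode (u v : ℕ) : Bool :=
  isId u || Nat.beq u v || Nat.beq u (mul v v) || Nat.beq u (mul v (mul v v))

theorem inCycCode_code {u v : S₆} (h : inCycCode (code u) (code v) = true) : InCycVal u v := by
  simp only [inCycCode, ← code_mul, Bool.or_eq_true, isId_code, beq_code] at h
  rw [InCycVal, pow_succ' v 2, pow_two]
  tauto

/-- A part of the formula `θ` for codes. -/
def thetaCode (u v w : ℕ) : Bool :=
  inCycCode u (mul v w) || inCycCode v (mul u w) || inCycCode w (mul u v) ||
    inCycCode (mul u v) (mul v w) || inCycCode (mul v w) (mul w u) || inCycCode (mul v u) (mul u w)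

theorem exists_perm_of_ne : ∀ i j k : Fin 3, i ≠ j → i ≠ k → j ≠ k →
    ∃ σ : Equiv.Perm (Fin 3), σ 0 = i ∧ σ 1 = j ∧ σ 2 = k := by
  decide

theorem thetaVal_of_inCyc₁ {y : Fin 3 → S₆} (i j k : Fin 3) (hij : i ≠ j) (hik : i ≠ k) (hjk : j ≠ k)
    (h : InCycVal (y i) (y j * y k)) : ThetaVal y := by
  obtain ⟨σ, rfl, rfl, rfl⟩ := exists_perm_of_ne i j k hij hik hjk
  exact Or.inr (Or.inl ⟨σ, h⟩)

theorem thetaVal_of_inCyc₂ {y : Fin 3 → S₆} (i j k : Fin 3) (hij : i ≠ j) (hik : i ≠ k) (hjk : j ≠ k)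
    (h : InCycVal (y i * y j) (y j * y k)) : ThetaVal y := by
  obtain ⟨σ, rfl, rfl, rfl⟩ := exists_perm_of_ne i j k hij hik hjk
  exact Or.inr (Or.inr ⟨σ, h⟩)

theorem thetaCode_code {y : Fin 3 → S₆} (h : thetaCode (code (y 0)) (code (y 1)) (code (y 2)) = true) :
    ThetaVal y := by
  simp only [thetaCode, ← code_mul] at h
  rw [Bool.or_eq_true, Bool.or_eq_true, Bool.or_eq_true, Bool.or_eq_true, Bool.or_eq_true] at h
  rcases h with ((((h | h) | h) | h) | h) | h
  · exact thetaVal_of_inCyc₁ 0 1 2 (by decide) (by decide) (by decide) (inCycCode_code h)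
  · exact thetaVal_of_inCyc₁ 1 0 2 (by decide) (by decide) (by decide) (inCycCode_code h)
  · exact thetaVal_of_inCyc₁ 2 0 1 (by decide) (by decide) (by decide) (inCycCode_code h)
  · exact thetaVal_of_inCyc₂ 0 1 2 (by decide) (by decide) (by decide) (inCycCode_code h)
  · exact thetaVal_of_inCyc₂ 1 2 0 (by decide) (by decide) (by decide) (inCycCode_code h)
  · exact thetaVal_of_inCyc₂ 1 0 2 (by decide) (by decide) (by decide) (inCycCode_code h)

theorem thetaVal_of_conj_eq {y : Fin 3 → S₆} (hy : ∀ i, sign (y i) = 1) {r c : S₆}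
    (hc : c * y 0 * c⁻¹ = r) (h1 : ∀ i, y i ^ 15 ≠ 1)
    (h2 : ∀ i j, i ≠ j → ¬ ((y i * y j) ^ 15 = 1 ∨ (y i * y j ^ 2) ^ 15 = 1 ∨
      (y i * y j ^ 3) ^ 15 = 1)) (l : List ℕ)
    (hl : allEven (fun b => (cube b || fifth b) || !evenProducts (code r) b ||
      !evenProducts b (code r) || l.contains b) = true)
    (hθ : (l.all fun u => l.all fun v => !evenProducts u v || !evenProducts v u ||
      thetaCode (code r) u v) = true) : ThetaVal y := by
  have hev : ∀ i j, i ≠ j →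
      evenProducts (code (MulAut.conj c (y i))) (code (MulAut.conj c (y j))) = true :=
    fun i j hij => evenProducts_code (by
      simpa only [← map_mul, ← map_pow, EmbeddingLike.map_eq_one_iff] using h2 i j hij)
  have hr : r = MulAut.conj c (y 0) := hc.symm
  have hmem : ∀ i, i ≠ 0 → code (MulAut.conj c (y i)) ∈ l := fun i hi => by
    have h3 := allEven_spec hl (sign_conj_eq (hy i) c)
    rw [hr, hev _ _ hi.symm, hev _ _ hi, Bool.not_true, Bool.or_false, Bool.or_false,
      Bool.or_eq_true] at h3
    rcases h3 with h3 | h3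
    · have h4 := pow_fifteen_of_code h3
      rw [← map_pow, EmbeddingLike.map_eq_one_iff] at h4
      exact absurd h4 (h1 i)
    · exact List.contains_iff_mem.1 h3
  have h3 := List.all_eq_true.1 (List.all_eq_true.1 hθ _ (hmem 1 (by decide))) _ (hmem 2 (by decide))
  rw [hr, hev _ _ (by decide), hev _ _ (by decide), Bool.not_true, Bool.false_or, Bool.false_or] at h3
  have h4 : ThetaVal fun i => MulAut.conj c (y i) := thetaCode_code h3
  simpa only [ThetaVal, InCycVal, ← map_mul, ← map_pow, EmbeddingLike.map_eq_one_iff,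
    EmbeddingLike.apply_eq_iff_eq] using h4

theorem delta5_perm {y : Fin 3 → S₆} (hy : ∀ i, sign (y i) = 1) :
    ThetaVal y ∨ (∃ i, y i ^ 15 = 1) ∨ ∃ i j, i ≠ j ∧ ((y i * y j) ^ 15 = 1 ∨
      (y i * y j ^ 2) ^ 15 = 1 ∨ (y i * y j ^ 3) ^ 15 = 1) := by
  by_cases h1 : ∃ i, y i ^ 15 = 1
  · exact Or.inr (Or.inl h1)
  by_cases h2 : ∃ i j, i ≠ j ∧ ((y i * y j) ^ 15 = 1 ∨
      (y i * y j ^ 2) ^ 15 = 1 ∨ (y i * y j ^ 3) ^ 15 = 1)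
  · exact Or.inr (Or.inr h2)
  left
  have h1 : ∀ i, y i ^ 15 ≠ 1 := fun i hi => h1 ⟨i, hi⟩
  have h2 : ∀ i j, i ≠ j → ¬ ((y i * y j) ^ 15 = 1 ∨ (y i * y j ^ 2) ^ 15 = 1 ∨
      (y i * y j ^ 3) ^ 15 = 1) := fun i j hij h => h2 ⟨i, j, hij, h⟩
  rcases orderOf_eq_two_or_four (hy 0) (h1 0) with h | h
  · obtain ⟨c, hc⟩ := exists_conj_eq_twoTwo h (hy 0)
    refine thetaVal_of_conj_eq hy hc h1 h2 [5356, 5797, 34021, 34476, 80200, 80641, 108865, 109320,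
      151691, 151761, 152216, 152258, 152601, 152643, 152776, 153098, 153168, 153217, 180307,
      180762] ?_ ?_
    · rw [code_twoTwo]; decide +kernel
    · rw [code_twoTwo]; decide +kernel
  · obtain ⟨c, hc⟩ := exists_conj_eq_fourTwo h (hy 0)
    refine thetaVal_of_conj_eq hy hc h1 h2 [152216, 153098, 180307, 181441] ?_ ?_
    · rw [code_fourTwo]; decide +kernel
    · rw [code_fourTwo]; decide +kernel

end SixPoints

theorem card_alternatingGroup_six : Nat.card (alternatingGroup (Fin 6)) = 360 := by
  have := two_mul_nat_card_alternatingGroup (α := Fin 6)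
  rw [Nat.card_perm, Nat.card_fin, show Nat.factorial 6 = 720 from rfl] at this
  omega

theorem omega_holdsIn_of_card_le {G : Type v} [Group G] [Finite G] {n : ℕ} (h : Nat.card G ≤ n) :
    (omega n).HoldsIn G := by
  rw [omega_holdsIn_iff]
  intro g
  have : Fintype G := Fintype.ofFinite G
  classical
  obtain ⟨i, hi, j, hj, hij, heq⟩ := Finset.exists_ne_map_eq_of_card_lt_of_maps_to
    (s := Finset.range (n + 1)) (t := (Finset.univ : Finset G)) (f := g)
    (by rw [Finset.card_univ, Finset.card_range, ← Nat.card_eq_fintype_card]; omega)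
    (fun _ _ => Finset.mem_coe.2 (Finset.mem_univ _))
  rw [Finset.mem_range] at hi hj
  rcases lt_or_gt_of_ne hij with hlt | hlt
  · exact ⟨i, j, hlt, by omega, heq⟩
  · exact ⟨j, i, hlt, by omega, heq.symm⟩

theorem satisfies_alternatingGroup_six : Satisfies (alternatingGroup (Fin 6)) sevenFormulas := by
  have hs : ∀ a : alternatingGroup (Fin 6), Equiv.Perm.sign (a : Equiv.Perm (Fin 6)) = 1 :=
    fun a => Equiv.Perm.mem_alternatingGroup.1 a.2
  have heq : ∀ a b : alternatingGroup (Fin 6), a = b ↔ (a : Equiv.Perm (Fin 6)) = b :=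
    fun a b => SetLike.coe_eq_coe.symm
  rw [satisfies_sevenFormulas_iff]
  refine ⟨omega_holdsIn_of_card_le card_alternatingGroup_six.le, delta2_holdsIn_iff.2 fun a => ?_,
    delta3_holdsIn_iff.2 fun g => ?_, delta4_holdsIn_iff.2 fun a b => ?_,
    delta5_holdsIn_iff.2 fun y => ?_, delta6_holdsIn_iff.2 fun a b => ?_,
    delta7_holdsIn_iff.2 fun a b => ?_⟩
  · simpa only [heq] using! SixPoints.pow_cases (hs a)
  · simpa only [heq] using! SixPoints.delta3_perm fun i => hs (g i)
  · simpa only [heq] using! SixPoints.delta4_perm (hs a) (hs b)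
  · simpa only [ThetaVal, InCycVal, heq] using! SixPoints.delta5_perm fun i => hs (y i)
  · simpa only [heq] using! SixPoints.delta6_perm (hs a) (hs b)
  · simpa only [heq] using! SixPoints.delta7_perm (hs a) (hs b)

theorem theorem3 :
    IsDBasis.{u} sevenFormulas (alternatingGroup (Fin 6)) ∧
    ∀ (G : Type u) [Group G], Satisfies G sevenFormulas →
      IsSection G (alternatingGroup (Fin 6)) := by
  have key : ∀ (G : Type u) [Group G], Satisfies G sevenFormulas →
      IsSection G (alternatingGroup (Fin 6)) := by
    intro G _ hG
    by_cases h : Nat.card G = 360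
    · obtain ⟨ψ, hψ, hr⟩ := hG.exists_injective_range_eq h
      obtain ⟨ψ', hψ', hr'⟩ :=
        satisfies_alternatingGroup_six.exists_injective_range_eq card_alternatingGroup_six
      let e : G ≃* alternatingGroup (Fin 6) :=
        ((MonoidHom.ofInjective hψ).trans (MulEquiv.subgroupCongr (hr.trans hr'.symm))).trans
          (MonoidHom.ofInjective hψ').symm
      exact isSection_of_injective e.toMonoidHom e.injective
    · exact hG.isSection_of_card_ne h
  exact ⟨⟨satisfies_alternatingGroup_six, fun G _ hG => (key G hG).inDVar⟩, key⟩
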